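/- Let $(X,\omega)$ be a closed symplectic manifold of dimension $2n$ and let $J$ be an $\omega$-tame almost complex structure on $X$. Let $N$ be a positive integer or $N=\infty$, put $V=\{0,1,\dots,N\}$ (so $V=\mathbb N$ if $N=\infty$), and let $\{L_i\}_{i\in V}$ be a collection of connected embedded Lagrangian submanifolds of $X$ such that the associated Lagrangian immersion $\iota_N: L=\bigsqcup_{i\in V}L_i\to X$ has transverse self-intersection, i.e. $L_i$ and $L_j$ intersect transversely for $i\neq j$. Let $E=L\times_X L=\{(p_1,p_2)\in L\times L\mid \iota_N(p_1)=\iota_N(p_2)\}$, regarded as the edges of a directed graph on the vertex set $\pi_0(L)$, where $(p_1,p_2)$ runs from the component of $p_1$ to that of $p_2$. A tuple $(e_1,\dots,e_k;e_0)$ of edges, $k\ge 0$, is a profile-loop if $e_1,\dots,e_k$ is a composable path (the empty path at a vertex if $k=0$) whose initial and final vertices are the source and the target of $e_0$. Let $\mathscr M_{\iota_N}=(\pi_0(L),L\times_X L,\mathcal M)$ be the vertically discrete $\mathbf{fc}$-multicategory (all vertical $1$-cells are identities) whose $0$-cells are the vertices and whose horizontal $1$-cells are the edges of this graph, and whose $2$-cells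 are as follows. They are, for $k\ge 0$, the isomorphism classes of $J$-holomorphic stable polygons $\mathbf u=(\Sigma,z_0,\dots,z_k,u,\gamma)$, together with one formal identity $2$-cell from $(e)$ to $e$ for each $e\in L\times_X L$. Here $\Sigma$ is a connected nodal bordered Riemann surface of genus $0$ (a nodal disk); $z_0,\dots,z_k\in\partial\Sigma$ are distinct non-nodal boundary points, ordered along $\partial\Sigma$; $u:\Sigma\to X$ is continuous and $J$-holomorphic on each component; $\gamma:\partial\Sigma\setminus\{z_0,\dots,z_k,\text{boundary nodes}\}\to L$ is continuous with $\iota_N\circ\gamma=u$, has one-sided limits $\gamma(z_j\pm)$ at the marked points and extends continuously when one follows the oriented boundary through a boundary node from one component to the other; and the automorphism group of $\mathbf u$ is finite. Isomorphisms are biholomorphisms which respect marked points, nodes, $u$ and $\gamma$. With $\gamma(z_j-)$ (resp. $\gamma(z_j+)$) the limit as $z_j$ is approached along (resp. against) the boundary orientation, the domain of $\mathbf u$ is $(\mathrm{ev}_1(\mathbf u),\dots,\mathrm{ev}_k(\mathbf u))$ with $\mathrm{ev}_i(\mathbf u)=(\gamma(z_i-),\gamma(z_i+))$, and its codomain is $\mathrm{ev}_0(\mathbf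 u)=(\gamma(z_0+),\gamma(z_0-))$; these form a profile-loop. If $\mathrm{ev}_i(\mathbf u)=\mathrm{ev}_0(\mathbf u')$, the partial composition $\mathbf u\circ_i\mathbf u'$ is obtained by gluing the output marked point of $\mathbf u'$ to the $i$-th input marked point of $\mathbf u$, creating a boundary node; the formal identities are units. Let $V=V'\sqcup V''$ be a partition (the parts may be empty), let $L'=\bigsqcup_{v\in V'}L_v$ and $L''=\bigsqcup_{v\in V''}L_v$, and let $E_0\subset E$ be the directed subgraph, on all vertices, with edge set \[ E_0=(L'\times_X L')\cup(L'\times_X L'')\cup(L''\times_X L''), \] that is, all edges except those whose source is in $L''$ and whose target is in $L'$. Let $\mathscr M_{\iota',\iota''}$ be the full $\mathbf{fc}$-submulticategory of $\mathscr M_{\iota_N}$ on $E_0$: its $2$-cells are all $2$-cells of $\mathscr M_{\iota_N}$ whose inputs and output lie in $E_0$. Then $\mathscr M_{\iota',\iota''}$ is factor-closed in $\mathscr M_{\iota_N}$: for all $2$-cells $\mathbf u,\mathbf u'$ of $\mathscr M_{\iota_N}$ such that the partial composition $\mathbf u\circ_i\mathbf u'$ is defined, if $\mathbf u\circ_i\mathbf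 u'$ is a $2$-cell of $\mathscr M_{\iota',\iota''}$, then so are $\mathbf u$ and $\mathbf u'$. -/

import Mathlib

open Set Filter Topology
open scoped Manifold

namespace FcPoly

universe u v w

noncomputable section

/-! ### Directed graphs and vertically discrete fc-multicategories -/

/-- A directed graph `(V, E, s, t)`. -/
structure DirGraph where
  V : Type u
  E : Type u
  s : E → V
  t : E → V

/-- `G.IsPath x es y`: the list `es` is a (possibly empty) composable path of edges from `x` to
`y`, read from its first edge to its last. -/
def DirGraph.IsPath (G : DirGraph.{u}) : G.V → List G.E → G.V → Prop
  | x, [], y => x = y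
  | x, e :: es, y => G.s e = x ∧ G.IsPath (G.t e) es y

/-- `(es ; e₀)` is a profile-loop: `es` is a composable path with the same endpoints as `e₀`. -/
def DirGraph.IsProfileLoop (G : DirGraph.{u}) (es : List G.E) (e₀ : G.E) : Prop :=
  G.IsPath (G.s e₀) es (G.t e₀)

/-- A directed subgraph `(V₀, E₀)` of `G`. -/
structure DirGraph.Subgraph (G : DirGraph.{u}) where
  verts : Set G.V
  edges : Set G.E
  s_mem : ∀ e ∈ edges, G.s e ∈ verts
  t_mem : ∀ e ∈ edges, G.t e ∈ verts

/-- A vertically discrete fc-multicategory with underlying directed graph `G`, presented by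
partial compositions. Its 0-cells are the vertices and its horizontal 1-cells the edges of `G`.
A 2-cell `x` has a domain `d x = (e₁, …, eₙ)` and a codomain `c x = e₀`, forming a profile-loop.
If `d x = a ++ c y :: b`, then `comp x y a b _` is the partial composition `x ∘ᵢ y` at the slot
`i = a.length + 1`. The laws are the sequential and parallel associativity laws and the unit
laws. -/
structure FcMulticategory (G : DirGraph.{u}) where
  Cell : Type w
  d : Cell → List G.E
  c : Cell → G.E
  profile : ∀ x, G.IsProfileLoop (d x) (c x)
  one : G.E → Cell
  d_one : ∀ e, d (one e) = [e]
  c_one : ∀ e, c (one e) = e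
  comp : ∀ (x y : Cell) (a b : List G.E), d x = a ++ c y :: b → Cell
  d_comp : ∀ x y a b h, d (comp x y a b h) = a ++ d y ++ b
  c_comp : ∀ x y a b h, c (comp x y a b h) = c x
  one_comp : ∀ e y a b h, comp (one e) y a b h = y
  comp_one : ∀ x e a b h, comp x (one e) a b h = x
  assoc_seq : ∀ (x y z : Cell) (a b a' b' : List G.E) (h : d x = a ++ c y :: b)
    (h' : d y = a' ++ c z :: b'),
    comp (comp x y a b h) z (a ++ a') (b' ++ b) (by rw [d_comp, h']; simp) =
      comp x (comp y z a' b' h') a b (by rw [c_comp, h])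
  assoc_par : ∀ (x y z : Cell) (a b b' : List G.E) (h : d x = a ++ c y :: (b ++ c z :: b')),
    comp (comp x y a (b ++ c z :: b') h) z (a ++ d y ++ b) b' (by rw [d_comp]; simp) =
      comp (comp x z (a ++ c y :: b) b' (by rw [h]; simp)) y a (b ++ d z ++ b')
        (by rw [d_comp]; simp)

namespace FcMulticategory

variable {G : DirGraph.{u}}

/-- An fc-submulticategory of a vertically discrete fc-multicategory: a subgraph and a set of
2-cells whose boundaries lie in it, containing identities and closed under composition. -/
structure Sub (M : FcMulticategory.{u, w} G) where
  graph : G.Subgraph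
  cells : Set M.Cell
  d_mem : ∀ x ∈ cells, ∀ e ∈ M.d x, e ∈ graph.edges
  c_mem : ∀ x ∈ cells, M.c x ∈ graph.edges
  one_mem : ∀ e ∈ graph.edges, M.one e ∈ cells
  comp_mem : ∀ x ∈ cells, ∀ y ∈ cells, ∀ a b h, M.comp x y a b h ∈ cells

/-- The full fc-submulticategory of `M` on the subgraph `G₀`: all 2-cells of `M` whose inputs and
output are edges of `G₀`. -/
def full (M : FcMulticategory.{u, w} G) (G₀ : G.Subgraph) : M.Sub where
  graph := G₀
  cells := {x | (∀ e ∈ M.d x, e ∈ G₀.edges) ∧ M.c x ∈ G₀.edges}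
  d_mem := fun _ hx => hx.1
  c_mem := fun _ hx => hx.2
  one_mem := fun e he => by simp [M.d_one, M.c_one, he]
  comp_mem := by
    rintro x ⟨hx, hx'⟩ y ⟨hy, hy'⟩ a b h
    rw [h] at hx
    refine ⟨fun e he => ?_, by rw [M.c_comp]; exact hx'⟩
    rw [M.d_comp] at he
    simp only [List.mem_append] at he
    rcases he with (he | he) | he
    · exact hx e (by simp [he])
    · exact hy e he
    · exact hx e (by simp [he])

/-- If a partial composition lies in the submulticategory, so do both factors. -/
def Sub.FactorClosed {M : FcMulticategory.{u, w} G} (M₀ : M.Sub) : Prop :=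
  ∀ (x y : M.Cell) (a b : List G.E) (h : M.d x = a ++ M.c y :: b),
    M.comp x y a b h ∈ M₀.cells → x ∈ M₀.cells ∧ y ∈ M₀.cells

end FcMulticategory

/-! ### The closed disk and the Riemann sphere -/

/-- The closed unit disk. -/
abbrev Disk : Type := Metric.closedBall (0 : ℂ) 1

/-- The Riemann sphere. -/
abbrev Sphere : Type := OnePoint ℂ

/-- A boundary point of the disk. -/
def bdry (a : Circle) : Disk := ⟨a, mem_closedBall_zero_iff.2 (Circle.norm_coe a).le⟩

theorem bdry_injective : Function.Injective bdry := fun a b h => by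
  apply Circle.ext
  exact congrArg (fun z : Disk => (z : ℂ)) h

/-- Holomorphic in the interior of the disk. -/
def IsHolDisk (f : Disk → Disk) : Prop :=
  ∃ F : ℂ → ℂ, DifferentiableOn ℂ F (Metric.ball 0 1) ∧
    ∀ z : Disk, ‖(z : ℂ)‖ < 1 → F z = f z

theorem IsHolDisk.comp {f g : Disk → Disk} (hf : IsHolDisk f) (hg : IsHolDisk g)
    (hb : ∀ z : Disk, ‖(g z : ℂ)‖ = 1 ↔ ‖(z : ℂ)‖ = 1) : IsHolDisk (fun z => f (g z)) := by
  obtain ⟨F, hF, hF'⟩ := hf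
  obtain ⟨H, hH, hH'⟩ := hg
  have key : ∀ z : Disk, ‖(z : ℂ)‖ < 1 → ‖(g z : ℂ)‖ < 1 := fun z hz =>
    lt_of_le_of_ne (mem_closedBall_zero_iff.1 (g z).2) (fun h => hz.ne ((hb z).1 h))
  refine ⟨F ∘ H, hF.comp hH ?_, fun z hz => ?_⟩
  · intro z hz
    rw [mem_ball_zero_iff] at hz
    have h1 := hH' ⟨z, mem_closedBall_zero_iff.2 hz.le⟩ hz
    rw [mem_ball_zero_iff]
    simp only at h1
    rw [h1]
    exact key _ hz
  · simp only [Function.comp]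
    rw [hH' z hz, hF' _ (key z hz)]

/-- The group of biholomorphisms of the closed disk: homeomorphisms that preserve the boundary and
are holomorphic in the interior, together with their inverses. -/
def DiskAut : Subgroup (Disk ≃ₜ Disk) where
  carrier := {φ | (∀ z : Disk, ‖(φ z : ℂ)‖ = 1 ↔ ‖(z : ℂ)‖ = 1) ∧ IsHolDisk φ ∧ IsHolDisk φ.symm}
  one_mem' := ⟨fun _ => Iff.rfl, ⟨id, differentiableOn_id, fun _ _ => rfl⟩,
    ⟨id, differentiableOn_id, fun _ _ => rfl⟩⟩
  mul_mem' := by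
    rintro φ ψ ⟨h1, h2, h3⟩ ⟨k1, k2, k3⟩
    refine ⟨fun z => (h1 _).trans (k1 z), h2.comp k2 k1, k3.comp h3 fun z => ?_⟩
    change ‖(φ.symm z : ℂ)‖ = 1 ↔ _
    rw [← h1 (φ.symm z), φ.apply_symm_apply]
  inv_mem' := by
    rintro φ ⟨h1, h2, h3⟩
    refine ⟨fun z => ?_, h3, h2⟩
    change ‖(φ.symm z : ℂ)‖ = 1 ↔ _
    rw [← h1 (φ.symm z), φ.apply_symm_apply]

/-- The group of biholomorphisms of the Riemann sphere, i.e. the Möbius transformations. -/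
def SphereAut : Subgroup (Equiv.Perm Sphere) :=
  (MulAction.toPermHom (GL (Fin 2) ℂ) (OnePoint ℂ)).range

/-- The action of a disk biholomorphism on the boundary circle. -/
def onCircle (φ : DiskAut) (a : Circle) : Circle :=
  ⟨φ.1 (bdry a), mem_sphere_zero_iff_norm.2 ((φ.2.1 (bdry a)).2 (Circle.norm_coe a))⟩

theorem bdry_onCircle (φ : DiskAut) (a : Circle) : bdry (onCircle φ a) = φ.1 (bdry a) := rfl

@[simp] theorem onCircle_one (a : Circle) : onCircle 1 a = a := rfl

theorem onCircle_mul (φ ψ : DiskAut) (a : Circle) :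
    onCircle (φ * ψ) a = onCircle φ (onCircle ψ a) := rfl

@[simp] theorem disk_one_apply (z : Disk) : (1 : DiskAut).1 z = z := rfl

@[simp] theorem sphere_one_apply (z : Sphere) : (1 : SphereAut).1 z = z := rfl

/-! ### Nodal disks -/

/-- Points of the disjoint union of disks (indexed by `D`) and spheres (indexed by `S`). -/
abbrev Pt (D S : Type) : Type := (D × Disk) ⊕ (S × Sphere)

section Points

variable {D S D' S' : Type}

/-- The component of a point. -/
def cpt : Pt D S → D ⊕ S := Sum.map Prod.fst Prod.fst

/-- A boundary point, regarded as a point. -/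
def bpt (p : D × Circle) : Pt D S := Sum.inl (p.1, bdry p.2)

/-- Being a boundary point. -/
def IsBdry (p : Pt D S) : Prop := ∃ b : D × Circle, p = bpt b

/-- The map on points induced by maps of the index sets and biholomorphisms of the components. -/
def mapPt (σ : D → D') (τ : S → S') (φ : D → DiskAut) (ψ : S → SphereAut) : Pt D S → Pt D' S'
  | Sum.inl (i, z) => Sum.inl (σ i, (φ i).1 z)
  | Sum.inr (i, z) => Sum.inr (τ i, (ψ i).1 z)

/-- The induced map on boundary points. -/
def mapB (σ : D → D') (φ : D → DiskAut) (p : D × Circle) : D' × Circle :=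
  (σ p.1, onCircle (φ p.1) p.2)

theorem mapPt_bpt (σ : D → D') (τ : S → S') (φ : D → DiskAut) (ψ : S → SphereAut)
    (p : D × Circle) : mapPt σ τ φ ψ (bpt p) = bpt (mapB σ φ p) := rfl

/-- The map on points given by maps on the disks and on the spheres. -/
def evalPt {X : Type u} (uD : D → ℂ → X) (uS : S → Sphere → X) : Pt D S → X
  | Sum.inl (i, z) => uD i z
  | Sum.inr (i, z) => uS i z

/-- The graph whose vertices are the components and whose edges are given by the nodes. -/
def dualGraph (node : Pt D S → Pt D S → Prop) : SimpleGraph (D ⊕ S) :=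
  SimpleGraph.fromRel fun x y => ∃ p q, node p q ∧ cpt p = x ∧ cpt q = y

/-- `Arc sp p q`: running counterclockwise along a boundary circle from `p`, the first point
satisfying `sp` that is met is `q` (possibly `p` itself, after a full turn). -/
def Arc (sp : D × Circle → Prop) (p q : D × Circle) : Prop :=
  ∃ θ : ℝ, 0 < θ ∧ θ ≤ 2 * Real.pi ∧ q = (p.1, p.2 * Circle.exp θ) ∧ sp q ∧
    ∀ t, 0 < t → t < θ → ¬ sp (p.1, p.2 * Circle.exp t)

/-- `Reach sp nd p q`: running along the boundary of the nodal disk from `p`, according to the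
boundary orientation and passing to the other branch at each boundary node met (the relation
`nd`), one arrives at `q`. -/
inductive Reach (sp : D × Circle → Prop) (nd : D × Circle → D × Circle → Prop) :
    D × Circle → D × Circle → Prop
  | arc {p q} : Arc sp p q → Reach sp nd p q
  | cross {p q q' r} : Reach sp nd p q → nd q q' → Arc sp q' r → Reach sp nd p r

end Points

/-- A connected nodal bordered Riemann surface of genus `0` with connected boundary, i.e. a
nodal disk, with boundary marked points. It is given by its normalization (a finite disjoint union
of disks and spheres), by the relation `node p q` that the distinct points `p` and `q` of the
normalization are the two branches of a node, by the marked point `out` (the point `z₀`) and by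
the list `inputs` of the marked points `z₁, …, z_k`.
A boundary node joins two boundary points of disks, an interior node joins an interior point of a
disk or a point of a sphere to a point of a sphere. Genus `0` means that the dual graph is a
tree, and the boundary is connected when the disks are connected to one another through boundary
nodes. Marked points are distinct and are not nodes, and following the oriented boundary from
`z₀` one meets `z₁, …, z_k` in this order before returning to `z₀`. -/
structure NodalDisk where
  D : Type
  S : Type
  finD : Finite D
  finS : Finite S
  node : Pt D S → Pt D S → Prop
  out : D × Circle
  inputs : List (D × Circle)
  node_symm : ∀ {p q}, node p q → node q p
  node_ne : ∀ {p q}, node p q → cpt p ≠ cpt q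
  node_unique : ∀ {p q q'}, node p q → node p q' → q = q'
  node_pair : ∀ {p q p' q'}, node p q → node p' q' → cpt p = cpt p' → cpt q = cpt q' → p = p'
  node_bdry : ∀ {p q}, node p q → IsBdry p → IsBdry q
  node_disks : ∀ {p q}, node (Sum.inl p) (Sum.inl q) → IsBdry (S := S) (Sum.inl p)
  tree : (dualGraph node).IsTree
  disks_connected : ((dualGraph node).comap Sum.inl).Connected
  nodup : (out :: inputs).Nodup
  not_node : ∀ p ∈ out :: inputs, ∀ q, ¬ node (bpt p) q
  order : List.IsChain
    (Reach (fun p => p ∈ out :: inputs ∨ ∃ q, node (bpt p) q) fun p q => node (bpt p) (bpt q))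
    (out :: inputs ++ [out])

/-- The boundary special points: marked points and boundary nodes. -/
def NodalDisk.Special (P : NodalDisk) (p : P.D × Circle) : Prop :=
  p ∈ P.out :: P.inputs ∨ ∃ q, P.node (bpt p) q

/-! ### Pseudo-holomorphic polygons -/

section Polygons

variable {E : Type*} [NormedAddCommGroup E] [NormedSpace ℝ E] {X : Type u} [TopologicalSpace X]
  [ChartedSpace E X] {L : Type v} [TopologicalSpace L]

/-- `f` is smooth and `J`-holomorphic on the open set `U`. -/
def IsJHolOn (J : ∀ x : X, TangentSpace 𝓘(ℝ, E) x →L[ℝ] TangentSpace 𝓘(ℝ, E) x)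
    (f : ℂ → X) (U : Set ℂ) : Prop :=
  ContMDiffOn 𝓘(ℝ, ℂ) 𝓘(ℝ, E) (⊤ : ℕ∞) f U ∧
    ∀ z ∈ U, ∀ v : ℂ, mfderiv 𝓘(ℝ, ℂ) 𝓘(ℝ, E) f z (Complex.I * v : ℂ) =
      J (f z) (mfderiv 𝓘(ℝ, ℂ) 𝓘(ℝ, E) f z v)

open Classical in
/-- The affine coordinate of the Riemann sphere centred at `∞`. -/
def sphereInv (z : ℂ) : Sphere :=
  if z = 0 then OnePoint.infty else ((z⁻¹ : ℂ) : OnePoint ℂ)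

/-- A `J`-holomorphic nodal polygon with boundary on the immersion `ι : L → X`, not yet assumed to
be stable. Only the values of `uD i` on the closed disk matter. For a boundary point `p`, the points
`γm p` and `γp p` of `L` are the limits of the boundary lift `γ` as `p` is approached along the
boundary orientation, respectively against it; away from marked points and nodes they agree and
are the value of `γ`. At a boundary node the lift continues from one branch to the other. -/
structure Polygon (J : ∀ x : X, TangentSpace 𝓘(ℝ, E) x →L[ℝ] TangentSpace 𝓘(ℝ, E) x)
    (ι : L → X) extends NodalDisk where
  uD : D → ℂ → X
  uS : S → Sphere → X
  γm : D × Circle → L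
  γp : D × Circle → L
  uD_cont : ∀ i, ContinuousOn (uD i) (Metric.closedBall 0 1)
  uD_hol : ∀ i, IsJHolOn J (uD i) (Metric.ball 0 1)
  uS_hol : ∀ i, IsJHolOn J (fun z : ℂ => uS i (z : OnePoint ℂ)) univ
  uS_hol_inv : ∀ i, IsJHolOn J (fun z : ℂ => uS i (sphereInv z)) univ
  u_node : ∀ {p q}, node p q → evalPt uD uS p = evalPt uD uS q
  ι_γm : ∀ p, ι (γm p) = uD p.1 p.2
  ι_γp : ∀ p, ι (γp p) = uD p.1 p.2
  γ_eq : ∀ p, ¬ toNodalDisk.Special p → γm p = γp p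
  γm_lim : ∀ p : D × Circle,
    Tendsto (fun t : ℝ => γm (p.1, p.2 * Circle.exp t)) (𝓝[<] 0) (𝓝 (γm p))
  γp_lim : ∀ p : D × Circle,
    Tendsto (fun t : ℝ => γp (p.1, p.2 * Circle.exp t)) (𝓝[>] 0) (𝓝 (γp p))
  γ_node : ∀ {p q}, node (bpt p) (bpt q) → γm p = γp q

variable {J : ∀ x : X, TangentSpace 𝓘(ℝ, E) x →L[ℝ] TangentSpace 𝓘(ℝ, E) x} {ι : L → X}

/-- The map `u` on all points of the normalization. -/
def Polygon.u (P : Polygon J ι) : Pt P.D P.S → X := evalPt P.uD P.uS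

/-- An isomorphism of nodal polygons: a biholomorphism (given on the normalizations) that
preserves nodes, marked points, the maps to `X` and the boundary lifts. -/
@[ext]
structure Polygon.Iso (P Q : Polygon J ι) where
  σ : P.D ≃ Q.D
  τ : P.S ≃ Q.S
  φ : P.D → DiskAut
  ψ : P.S → SphereAut
  node_iff : ∀ p q, Q.node (mapPt σ τ φ ψ p) (mapPt σ τ φ ψ q) ↔ P.node p q
  out_eq : mapB σ φ P.out = Q.out
  inputs_eq : P.inputs.map (mapB σ φ) = Q.inputs
  u_eq : ∀ p, Q.u (mapPt σ τ φ ψ p) = P.u p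
  γm_eq : ∀ p, Q.γm (mapB σ φ p) = P.γm p
  γp_eq : ∀ p, Q.γp (mapB σ φ p) = P.γp p

variable (J ι) in
/-- A stable polygon: the automorphism group is finite. -/
structure StablePolygon extends Polygon J ι where
  stable : Finite (toPolygon.Iso toPolygon)

end Polygons

/-! ### Gluing at a boundary node -/

section Glue

variable {D S D' S' : Type}

/-- Inclusion of the points of the first piece. -/
def k₁ : Pt D S → Pt (D ⊕ D') (S ⊕ S')
  | Sum.inl (i, z) => Sum.inl (Sum.inl i, z)
  | Sum.inr (i, z) => Sum.inr (Sum.inl i, z)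

/-- Inclusion of the points of the second piece. -/
def k₂ : Pt D' S' → Pt (D ⊕ D') (S ⊕ S')
  | Sum.inl (i, z) => Sum.inl (Sum.inr i, z)
  | Sum.inr (i, z) => Sum.inr (Sum.inr i, z)

/-- Inclusion of the boundary points of the first piece. -/
def b₁ (p : D × Circle) : (D ⊕ D') × Circle := (Sum.inl p.1, p.2)

/-- Inclusion of the boundary points of the second piece. -/
def b₂ (p : D' × Circle) : (D ⊕ D') × Circle := (Sum.inr p.1, p.2)

/-- The piece to which a point belongs. -/
def splitPt : Pt (D ⊕ D') (S ⊕ S') → Pt D S ⊕ Pt D' S'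
  | Sum.inl (Sum.inl i, z) => Sum.inl (Sum.inl (i, z))
  | Sum.inl (Sum.inr i, z) => Sum.inr (Sum.inl (i, z))
  | Sum.inr (Sum.inl i, z) => Sum.inl (Sum.inr (i, z))
  | Sum.inr (Sum.inr i, z) => Sum.inr (Sum.inr (i, z))

@[simp] theorem splitPt_k₁ (p : Pt D S) : splitPt (k₁ p : Pt (D ⊕ D') (S ⊕ S')) = Sum.inl p := by
  rcases p with ⟨_, _⟩ | ⟨_, _⟩ <;> rfl

@[simp] theorem splitPt_k₂ (p : Pt D' S') : splitPt (k₂ p : Pt (D ⊕ D') (S ⊕ S')) = Sum.inr p := by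
  rcases p with ⟨_, _⟩ | ⟨_, _⟩ <;> rfl

theorem pt_cases {C : Pt (D ⊕ D') (S ⊕ S') → Prop} (h₁ : ∀ p, C (k₁ p)) (h₂ : ∀ p, C (k₂ p)) :
    ∀ p, C p := by
  rintro (⟨i | i, z⟩ | ⟨i | i, z⟩)
  · exact h₁ (Sum.inl (i, z))
  · exact h₂ (Sum.inl (i, z))
  · exact h₁ (Sum.inr (i, z))
  · exact h₂ (Sum.inr (i, z))

theorem b_cases {C : (D ⊕ D') × Circle → Prop} (h₁ : ∀ p, C (b₁ p)) (h₂ : ∀ p, C (b₂ p)) :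
    ∀ p, C p := by
  rintro ⟨i | i, z⟩
  · exact h₁ (i, z)
  · exact h₂ (i, z)

@[simp] theorem k₁_inj {p q : Pt D S} : (k₁ p : Pt (D ⊕ D') (S ⊕ S')) = k₁ q ↔ p = q :=
  ⟨fun h => by simpa using congrArg splitPt h, fun h => h ▸ rfl⟩

@[simp] theorem k₂_inj {p q : Pt D' S'} : (k₂ p : Pt (D ⊕ D') (S ⊕ S')) = k₂ q ↔ p = q :=
  ⟨fun h => by simpa using congrArg splitPt h, fun h => h ▸ rfl⟩

@[simp] theorem k₁_ne_k₂ {p : Pt D S} {q : Pt D' S'} : (k₁ p : Pt (D ⊕ D') (S ⊕ S')) ≠ k₂ q :=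
  fun h => by simpa using congrArg splitPt h

@[simp] theorem k₂_ne_k₁ {p : Pt D S} {q : Pt D' S'} : (k₂ q : Pt (D ⊕ D') (S ⊕ S')) ≠ k₁ p :=
  fun h => by simpa using congrArg splitPt h

theorem b₁_injective : Function.Injective (b₁ : D × Circle → (D ⊕ D') × Circle) := by
  rintro ⟨i, z⟩ ⟨j, w⟩ h
  simpa [b₁] using h

theorem b₂_injective : Function.Injective (b₂ : D' × Circle → (D ⊕ D') × Circle) := by
  rintro ⟨i, z⟩ ⟨j, w⟩ h
  simpa [b₂] using h

@[simp] theorem b₁_inj {p q : D × Circle} : (b₁ p : (D ⊕ D') × Circle) = b₁ q ↔ p = q :=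
  b₁_injective.eq_iff

@[simp] theorem b₂_inj {p q : D' × Circle} : (b₂ p : (D ⊕ D') × Circle) = b₂ q ↔ p = q :=
  b₂_injective.eq_iff

@[simp] theorem b₁_ne_b₂ {p : D × Circle} {q : D' × Circle} :
    (b₁ p : (D ⊕ D') × Circle) ≠ b₂ q := by simp [b₁, b₂]

@[simp] theorem b₂_ne_b₁ {p : D × Circle} {q : D' × Circle} :
    (b₂ q : (D ⊕ D') × Circle) ≠ b₁ p := by simp [b₁, b₂]

theorem bpt_injective : Function.Injective (bpt : D × Circle → Pt D S) := by
  rintro ⟨i, z⟩ ⟨j, w⟩ h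
  simp only [bpt, Sum.inl.injEq, Prod.mk.injEq] at h
  exact Prod.ext h.1 (bdry_injective h.2)

@[simp] theorem bpt_inj {p q : D × Circle} : (bpt p : Pt D S) = bpt q ↔ p = q :=
  bpt_injective.eq_iff

theorem bpt_b₁ (p : D × Circle) : (bpt (b₁ p) : Pt (D ⊕ D') (S ⊕ S')) = k₁ (bpt p) := rfl

theorem bpt_b₂ (p : D' × Circle) : (bpt (b₂ p) : Pt (D ⊕ D') (S ⊕ S')) = k₂ (bpt p) := rfl

theorem isBdry_k₁ {p : Pt D S} : IsBdry (k₁ p : Pt (D ⊕ D') (S ⊕ S')) ↔ IsBdry p := by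
  constructor
  · rintro ⟨b, hb⟩
    revert hb
    refine b_cases (C := fun b => k₁ p = bpt b → IsBdry p) (fun b hb => ?_) (fun b hb => ?_) b
    · rw [bpt_b₁, k₁_inj] at hb
      exact ⟨b, hb⟩
    · rw [bpt_b₂] at hb
      exact absurd hb k₁_ne_k₂
  · rintro ⟨b, rfl⟩
    exact ⟨b₁ b, rfl⟩

theorem isBdry_k₂ {p : Pt D' S'} : IsBdry (k₂ p : Pt (D ⊕ D') (S ⊕ S')) ↔ IsBdry p := by
  constructor
  · rintro ⟨b, hb⟩
    revert hb
    refine b_cases (C := fun b => k₂ p = bpt b → IsBdry p) (fun b hb => ?_) (fun b hb => ?_) b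
    · rw [bpt_b₁] at hb
      exact absurd hb k₂_ne_k₁
    · rw [bpt_b₂, k₂_inj] at hb
      exact ⟨b, hb⟩
  · rintro ⟨b, rfl⟩
    exact ⟨b₂ b, rfl⟩

theorem cpt_k₁ (p : Pt D S) :
    cpt (k₁ p : Pt (D ⊕ D') (S ⊕ S')) = Sum.map Sum.inl Sum.inl (cpt p) := by
  rcases p with ⟨_, _⟩ | ⟨_, _⟩ <;> rfl

theorem cpt_k₂ (p : Pt D' S') :
    cpt (k₂ p : Pt (D ⊕ D') (S ⊕ S')) = Sum.map Sum.inr Sum.inr (cpt p) := by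
  rcases p with ⟨_, _⟩ | ⟨_, _⟩ <;> rfl

theorem c₁_inj {x y : D ⊕ S} : (Sum.map Sum.inl Sum.inl x : (D ⊕ D') ⊕ (S ⊕ S')) =
    Sum.map Sum.inl Sum.inl y ↔ x = y :=
  (Sum.map_injective.2 ⟨Sum.inl_injective, Sum.inl_injective⟩).eq_iff

theorem c₂_inj {x y : D' ⊕ S'} : (Sum.map Sum.inr Sum.inr x : (D ⊕ D') ⊕ (S ⊕ S')) =
    Sum.map Sum.inr Sum.inr y ↔ x = y :=
  (Sum.map_injective.2 ⟨Sum.inr_injective, Sum.inr_injective⟩).eq_iff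

theorem c₁_ne_c₂ {x : D ⊕ S} {y : D' ⊕ S'} : (Sum.map Sum.inl Sum.inl x : (D ⊕ D') ⊕ (S ⊕ S')) ≠
    Sum.map Sum.inr Sum.inr y := by
  rcases x with x | x <;> rcases y with y | y <;> simp

/-- The nodes after gluing: those of the two pieces, and one new node joining `z` and `w`. -/
def glueNode (n₁ : Pt D S → Pt D S → Prop) (n₂ : Pt D' S' → Pt D' S' → Prop) (z : Pt D S)
    (w : Pt D' S') (p q : Pt (D ⊕ D') (S ⊕ S')) : Prop :=
  match splitPt p, splitPt q with
  | Sum.inl a, Sum.inl b => n₁ a b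
  | Sum.inr a, Sum.inr b => n₂ a b
  | Sum.inl a, Sum.inr b => a = z ∧ b = w
  | Sum.inr a, Sum.inl b => a = w ∧ b = z

section
variable {n₁ : Pt D S → Pt D S → Prop} {n₂ : Pt D' S' → Pt D' S' → Prop} {z : Pt D S}
  {w : Pt D' S'}

@[simp] theorem glueNode₁₁ {a b : Pt D S} : glueNode n₁ n₂ z w (k₁ a) (k₁ b) ↔ n₁ a b := by
  simp [glueNode]

@[simp] theorem glueNode₂₂ {a b : Pt D' S'} : glueNode n₁ n₂ z w (k₂ a) (k₂ b) ↔ n₂ a b := by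
  simp [glueNode]

@[simp] theorem glueNode₁₂ {a : Pt D S} {b : Pt D' S'} :
    glueNode n₁ n₂ z w (k₁ a) (k₂ b) ↔ a = z ∧ b = w := by
  simp [glueNode]

@[simp] theorem glueNode₂₁ {a : Pt D S} {b : Pt D' S'} :
    glueNode n₁ n₂ z w (k₂ b) (k₁ a) ↔ b = w ∧ a = z := by
  simp [glueNode]

end

theorem connected_join {V V' : Type} {G : SimpleGraph V} {G' : SimpleGraph V'}
    {H : SimpleGraph (V ⊕ V')} (hG : G.Connected) (hG' : G'.Connected)
    (f : ∀ x y, G.Adj x y → H.Adj (Sum.inl x) (Sum.inl y))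
    (f' : ∀ x y, G'.Adj x y → H.Adj (Sum.inr x) (Sum.inr y)) {a : V} {b : V'}
    (hab : H.Adj (Sum.inl a) (Sum.inr b)) : H.Connected := by
  have h1 : ∀ x y, H.Reachable (Sum.inl x) (Sum.inl y) := fun x y =>
    (hG.preconnected x y).map (⟨Sum.inl, fun h => f _ _ h⟩ : G →g H)
  have h2 : ∀ x y, H.Reachable (Sum.inr x) (Sum.inr y) := fun x y =>
    (hG'.preconnected x y).map (⟨Sum.inr, fun h => f' _ _ h⟩ : G' →g H)
  have h3 : ∀ x y, H.Reachable (Sum.inl x) (Sum.inr y) := fun x y =>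
    ((h1 x a).trans hab.reachable).trans (h2 b y)
  have : Nonempty (V ⊕ V') := ⟨Sum.inl a⟩
  refine ⟨fun x y => ?_⟩
  rcases x with x | x <;> rcases y with y | y
  · exact h1 x y
  · exact h3 x y
  · exact (h3 y x).symm
  · exact h2 x y

theorem acyclic_sum {V V' : Type} {G : SimpleGraph V} {G' : SimpleGraph V'}
    (hG : G.IsAcyclic) (hG' : G'.IsAcyclic) : (G ⊕g G').IsAcyclic := by
  have key1 : ∀ (x y : V ⊕ V') (p : (G ⊕g G').Walk x y) (a : V) (hx : x = Sum.inl a),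
      ∃ (b : V) (hy : y = Sum.inl b) (q : G.Walk a b),
        (q.map (SimpleGraph.Embedding.sumInl (G := G) (H := G')).toHom) = p.copy hx hy := by
    intro x y p
    induction p with
    | nil => rintro a rfl; exact ⟨a, rfl, .nil, rfl⟩
    | @cons x m y h p ih =>
      rintro a rfl
      rcases m with m | m
      · obtain ⟨b, rfl, q, hq⟩ := ih m rfl
        refine ⟨b, rfl, .cons (by simpa using h) q, ?_⟩
        simp only [SimpleGraph.Walk.map_cons, hq]
        rfl
      · simp at h
  have key2 : ∀ (x y : V ⊕ V') (p : (G ⊕g G').Walk x y) (a : V') (hx : x = Sum.inr a),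
      ∃ (b : V') (hy : y = Sum.inr b) (q : G'.Walk a b),
        (q.map (SimpleGraph.Embedding.sumInr (G := G) (H := G')).toHom) = p.copy hx hy := by
    intro x y p
    induction p with
    | nil => rintro a rfl; exact ⟨a, rfl, .nil, rfl⟩
    | @cons x m y h p ih =>
      rintro a rfl
      rcases m with m | m
      · simp at h
      · obtain ⟨b, rfl, q, hq⟩ := ih m rfl
        refine ⟨b, rfl, .cons (by simpa using h) q, ?_⟩
        simp only [SimpleGraph.Walk.map_cons, hq]
        rfl
  intro x p hp
  rcases x with x | x
  · obtain ⟨b, hb, q, hq⟩ := key1 _ _ p x rfl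
    obtain rfl := Sum.inl.inj hb
    refine hG q ?_
    rw [← SimpleGraph.Walk.isCycle_map_iff_of_injective
      (f := (SimpleGraph.Embedding.sumInl (G := G) (H := G')).toHom)
      (SimpleGraph.Embedding.sumInl (G := G) (H := G')).injective]
    have : q.map (SimpleGraph.Embedding.sumInl (G := G) (H := G')).toHom = p := hq
    exact this ▸ hp
  · obtain ⟨b, hb, q, hq⟩ := key2 _ _ p x rfl
    obtain rfl := Sum.inr.inj hb
    refine hG' q ?_
    rw [← SimpleGraph.Walk.isCycle_map_iff_of_injective
      (f := (SimpleGraph.Embedding.sumInr (G := G) (H := G')).toHom)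
      (SimpleGraph.Embedding.sumInr (G := G) (H := G')).injective]
    have : q.map (SimpleGraph.Embedding.sumInr (G := G) (H := G')).toHom = p := hq
    exact this ▸ hp

theorem tree_join {V V' : Type} {G : SimpleGraph V} {G' : SimpleGraph V'}
    (hG : G.IsTree) (hG' : G'.IsTree) (a : V) (b : V') :
    ((G ⊕g G') ⊔ SimpleGraph.edge (Sum.inl a) (Sum.inr b)).IsTree := by
  refine ⟨connected_join hG.connected hG'.connected (a := a) (b := b) ?_ ?_ ?_, ?_⟩
  · intro x y h; exact Or.inl (by simpa using h)
  · intro x y h; exact Or.inl (by simpa using h)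
  · exact Or.inr (by simp [SimpleGraph.edge_adj])
  · refine SimpleGraph.IsAcyclic.sup_edge_of_not_reachable ?_
      (acyclic_sum hG.isAcyclic hG'.isAcyclic)
    rintro ⟨p⟩
    have : ∀ (x y : V ⊕ V') (p : (G ⊕g G').Walk x y), x.isLeft = y.isLeft := by
      intro x y p
      induction p with
      | nil => rfl
      | @cons x m y h p ih =>
        rw [← ih]
        rcases x with x | x <;> rcases m with m | m <;> simp at h ⊢
    simpa using this _ _ p

theorem dualGraph_glue {n₁ : Pt D S → Pt D S → Prop} {n₂ : Pt D' S' → Pt D' S' → Prop}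
    {z : Pt D S} {w : Pt D' S'} (x y : (D ⊕ S) ⊕ (D' ⊕ S')) :
    (dualGraph (glueNode n₁ n₂ z w)).Adj (Equiv.sumSumSumComm _ _ _ _ x)
      (Equiv.sumSumSumComm _ _ _ _ y) ↔
    ((dualGraph n₁ ⊕g dualGraph n₂) ⊔ SimpleGraph.edge (Sum.inl (cpt z)) (Sum.inr (cpt w))).Adj
      x y := by
  have e1 : ∀ x : D ⊕ S, Equiv.sumSumSumComm D S D' S' (Sum.inl x) =
    Sum.map Sum.inl Sum.inl x := by rintro (x | x) <;> rfl
  have e2 : ∀ x : D' ⊕ S', Equiv.sumSumSumComm D S D' S' (Sum.inr x) =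
    Sum.map Sum.inr Sum.inr x := by rintro (x | x) <;> rfl
  have r11 : ∀ x y : D ⊕ S, (∃ p q, glueNode n₁ n₂ z w p q ∧ cpt p = Sum.map Sum.inl Sum.inl x ∧
      cpt q = Sum.map Sum.inl Sum.inl y) ↔ ∃ p q, n₁ p q ∧ cpt p = x ∧ cpt q = y := by
    intro x y
    constructor
    · rintro ⟨p, q, h⟩
      induction p using pt_cases with
      | h₁ p =>
        induction q using pt_cases with
        | h₁ q => exact ⟨p, q, by simpa [cpt_k₁, c₁_inj] using h⟩
        | h₂ q => rw [cpt_k₂] at h; exact absurd h.2.2.symm c₁_ne_c₂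
      | h₂ p => rw [cpt_k₂] at h; exact absurd h.2.1.symm c₁_ne_c₂
    · rintro ⟨p, q, h, rfl, rfl⟩
      exact ⟨k₁ p, k₁ q, by simpa using h, cpt_k₁ _, cpt_k₁ _⟩
  have r22 : ∀ x y : D' ⊕ S', (∃ p q, glueNode n₁ n₂ z w p q ∧ cpt p = Sum.map Sum.inr Sum.inr x ∧
      cpt q = Sum.map Sum.inr Sum.inr y) ↔ ∃ p q, n₂ p q ∧ cpt p = x ∧ cpt q = y := by
    intro x y
    constructor
    · rintro ⟨p, q, h⟩
      induction p using pt_cases with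
      | h₂ p =>
        induction q using pt_cases with
        | h₂ q => exact ⟨p, q, by simpa [cpt_k₂, c₂_inj] using h⟩
        | h₁ q => rw [cpt_k₁] at h; exact absurd h.2.2 c₁_ne_c₂
      | h₁ p => rw [cpt_k₁] at h; exact absurd h.2.1 c₁_ne_c₂
    · rintro ⟨p, q, h, rfl, rfl⟩
      exact ⟨k₂ p, k₂ q, by simpa using h, cpt_k₂ _, cpt_k₂ _⟩
  have r12 : ∀ (x : D ⊕ S) (y : D' ⊕ S'), (∃ p q, glueNode n₁ n₂ z w p q ∧
      cpt p = Sum.map Sum.inl Sum.inl x ∧ cpt q = Sum.map Sum.inr Sum.inr y) ↔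
      x = cpt z ∧ y = cpt w := by
    intro x y
    constructor
    · rintro ⟨p, q, h⟩
      induction p using pt_cases with
      | h₁ p =>
        induction q using pt_cases with
        | h₂ q =>
          simp only [glueNode₁₂, cpt_k₁, cpt_k₂, c₁_inj, c₂_inj] at h
          obtain ⟨⟨rfl, rfl⟩, rfl, rfl⟩ := h
          exact ⟨rfl, rfl⟩
        | h₁ q => rw [cpt_k₁, cpt_k₁] at h; exact absurd h.2.2 c₁_ne_c₂
      | h₂ p => rw [cpt_k₂] at h; exact absurd h.2.1.symm c₁_ne_c₂
    · rintro ⟨rfl, rfl⟩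
      exact ⟨k₁ z, k₂ w, by simp, cpt_k₁ _, cpt_k₂ _⟩
  have r21 : ∀ (x : D ⊕ S) (y : D' ⊕ S'), (∃ p q, glueNode n₁ n₂ z w p q ∧
      cpt p = Sum.map Sum.inr Sum.inr y ∧ cpt q = Sum.map Sum.inl Sum.inl x) ↔
      x = cpt z ∧ y = cpt w := by
    intro x y
    constructor
    · rintro ⟨p, q, h⟩
      induction p using pt_cases with
      | h₂ p =>
        induction q using pt_cases with
        | h₁ q =>
          simp only [glueNode₂₁, cpt_k₁, cpt_k₂, c₁_inj, c₂_inj] at h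
          obtain ⟨⟨rfl, rfl⟩, rfl, rfl⟩ := h
          exact ⟨rfl, rfl⟩
        | h₂ q => rw [cpt_k₂, cpt_k₂] at h; exact absurd h.2.2.symm c₁_ne_c₂
      | h₁ p => rw [cpt_k₁] at h; exact absurd h.2.1 c₁_ne_c₂
    · rintro ⟨rfl, rfl⟩
      exact ⟨k₂ w, k₁ z, by simp, cpt_k₂ _, cpt_k₁ _⟩
  rcases x with x | x <;> rcases y with y | y
  · simp only [e1, dualGraph, SimpleGraph.fromRel_adj, r11, SimpleGraph.sup_adj,
      SimpleGraph.edge_adj, SimpleGraph.sum_adj_inl]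
    simp only [ne_eq, c₁_inj, reduceCtorEq, false_and, and_false, or_false]
  · simp only [e1, e2, dualGraph, SimpleGraph.fromRel_adj, r12, r21, SimpleGraph.sup_adj,
      SimpleGraph.edge_adj]
    simp only [ne_eq, c₁_ne_c₂, not_false_eq_true, true_and, or_self, Sum.inl.injEq,
      Sum.inr.injEq, reduceCtorEq, and_true, false_and, or_false]
    constructor
    · exact fun h => Or.inr h
    · rintro (h | h)
      · exact absurd h (by simp)
      · exact h
  · simp only [e1, e2, dualGraph, SimpleGraph.fromRel_adj, r12, r21, SimpleGraph.sup_adj,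
      SimpleGraph.edge_adj]
    simp only [ne_eq, c₁_ne_c₂.symm, not_false_eq_true, true_and, or_self, Sum.inl.injEq,
      Sum.inr.injEq, reduceCtorEq, and_true, false_and, false_or]
    constructor
    · exact fun h => Or.inr ⟨h.2, h.1⟩
    · rintro (h | h)
      · exact absurd h (by simp)
      · exact ⟨h.2, h.1⟩
  · simp only [e2, dualGraph, SimpleGraph.fromRel_adj, r22, SimpleGraph.sup_adj,
      SimpleGraph.edge_adj, SimpleGraph.sum_adj_inr]
    simp only [ne_eq, c₂_inj, reduceCtorEq, false_and, and_false, or_false]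

theorem chain_glue {α β γ : Type} {R₁ : α → α → Prop} {R₂ : β → β → Prop} {R : γ → γ → Prop}
    {f : α → γ} {g : β → γ} {z : α} {w : β} (h₁ : ∀ a b, R₁ a b → R (f a) (f b))
    (h₂ : ∀ a b, R₂ a b → R (g a) (g b))
    (h₁₂ : ∀ a b, R₁ a z → R₂ w b → R (f a) (g b))
    (h₂₁ : ∀ a b, R₂ a w → R₁ z b → R (g a) (f b))
    (h₁₁ : ∀ a b, R₁ a z → R₂ w w → R₁ z b → R (f a) (f b))
    {A B : List α} {M : List β} (hB : B ≠ [])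
    (hc : List.IsChain R₁ (A ++ z :: B)) (hd : List.IsChain R₂ (w :: M ++ [w])) :
    List.IsChain R (A.map f ++ M.map g ++ B.map f) := by
  obtain ⟨b, B, rfl⟩ := List.exists_cons_of_ne_nil hB
  rw [List.isChain_append] at hc
  obtain ⟨hA, hzB, hAz⟩ := hc
  rw [List.isChain_cons_cons] at hzB
  obtain ⟨hzb, hbB⟩ := hzB
  have cA : List.IsChain R (A.map f) := (List.isChain_map f).2 (hA.imp h₁)
  have cB : List.IsChain R ((b :: B).map f) := (List.isChain_map f).2 (hbB.imp h₁)
  have hAz' : ∀ x ∈ A.getLast?, R₁ x z := fun x hx => hAz x hx z (by simp)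
  rcases List.eq_nil_or_concat M with rfl | ⟨M, m, rfl⟩
  · simp only [List.cons_append, List.nil_append, List.isChain_cons_cons] at hd
    simp only [List.map_nil, List.append_nil]
    rw [List.isChain_append]
    refine ⟨cA, cB, ?_⟩
    intro x hx y hy
    simp only [List.getLast?_map, Option.mem_def, Option.map_eq_some_iff] at hx
    obtain ⟨x, hx, rfl⟩ := hx
    simp only [List.map_cons, List.head?_cons, Option.mem_def, Option.some.injEq] at hy
    subst hy
    exact h₁₁ _ _ (hAz' x hx) hd.1 hzb
  · rw [List.concat_eq_append] at *
    rw [List.cons_append, List.isChain_cons] at hd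
    obtain ⟨hw, hd⟩ := hd
    rw [List.isChain_append] at hd
    obtain ⟨hM, -, hmw⟩ := hd
    have cM : List.IsChain R ((M ++ [m]).map g) := (List.isChain_map g).2 (hM.imp h₂)
    rw [List.isChain_append, List.isChain_append]
    refine ⟨⟨cA, cM, ?_⟩, cB, ?_⟩
    · intro x hx y hy
      simp only [List.getLast?_map, Option.mem_def, Option.map_eq_some_iff] at hx
      obtain ⟨x, hx, rfl⟩ := hx
      simp only [List.head?_map, Option.mem_def, Option.map_eq_some_iff] at hy
      obtain ⟨y, hy, rfl⟩ := hy
      refine h₁₂ _ _ (hAz' x hx) (hw y ?_)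
      rw [List.head?_append, hy]; rfl
    · intro x hx y hy
      have : (A.map f ++ (M ++ [m]).map g).getLast? = some (g m) := by simp
      rw [this] at hx
      simp only [Option.mem_def, Option.some.injEq] at hx
      simp only [List.map_cons, List.head?_cons, Option.mem_def, Option.some.injEq] at hy
      subst hx hy
      exact h₂₁ _ _ (hmw m (by simp) w (by simp)) hzb

theorem Arc.map {sp : D × Circle → Prop} {sp' : D' × Circle → Prop} (f : D → D')
    (h : ∀ p : D × Circle, sp' (f p.1, p.2) ↔ sp p) {p q : D × Circle} (hpq : Arc sp p q) :
    Arc sp' (f p.1, p.2) (f q.1, q.2) := by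
  obtain ⟨θ, h1, h2, rfl, h4, h5⟩ := hpq
  exact ⟨θ, h1, h2, rfl, (h _).2 h4, fun t ht ht' =>
    mt (h (p.1, p.2 * Circle.exp t)).1 (h5 t ht ht')⟩

theorem Reach.map {sp : D × Circle → Prop} {sp' : D' × Circle → Prop}
    {nd : D × Circle → D × Circle → Prop} {nd' : D' × Circle → D' × Circle → Prop} (f : D → D')
    (h : ∀ p : D × Circle, sp' (f p.1, p.2) ↔ sp p)
    (hn : ∀ p q : D × Circle, nd p q → nd' (f p.1, p.2) (f q.1, q.2)) {p q : D × Circle}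
    (hpq : Reach sp nd p q) : Reach sp' nd' (f p.1, p.2) (f q.1, q.2) := by
  induction hpq with
  | arc ha => exact .arc (ha.map f h)
  | cross _ h2 h3 ih => exact .cross ih (hn _ _ h2) (h3.map f h)

theorem Reach.trans {sp : D × Circle → Prop} {nd : D × Circle → D × Circle → Prop}
    {p q q' r : D × Circle} (h : Reach sp nd p q) (h' : Reach sp nd q' r) :
    nd q q' → Reach sp nd p r := by
  induction h' with
  | arc ha => exact fun hn => .cross h hn ha
  | cross _ h2 h3 ih => exact fun hn => .cross (ih hn) h2 h3

end Glue

theorem special₁ (P Q : NodalDisk) (pre : List (P.D × Circle)) (z : P.D × Circle)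
    (post : List (P.D × Circle)) (hz : P.inputs = pre ++ z :: post) :
    ∀ p : P.D × Circle, ((b₁ p : (P.D ⊕ Q.D) × Circle) ∈
      b₁ P.out :: (pre.map b₁ ++ Q.inputs.map b₂ ++ post.map b₁) ∨
      ∃ q, glueNode P.node Q.node (bpt z) (bpt Q.out) (bpt (b₁ p)) q) ↔
      (p ∈ P.out :: P.inputs ∨ ∃ q, P.node (bpt p) q) := by
    intro p
    rw [hz, bpt_b₁]
    constructor
    · rintro (h | ⟨q, h⟩)
      · left
        have : p = P.out ∨ p ∈ pre ∨ p ∈ post := by simpa [or_assoc] using h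
        grind
      · induction q using pt_cases with
        | h₁ q => exact Or.inr ⟨q, by simpa using h⟩
        | h₂ q =>
          have : p = z := by simpa using (glueNode₁₂.1 h).1
          left; simp [this]
    · rintro (h | ⟨q, h⟩)
      · by_cases hpz : p = z
        · exact Or.inr ⟨k₂ (bpt Q.out), by simp [hpz]⟩
        · left
          have : p = P.out ∨ p ∈ pre ∨ p ∈ post := by grind
          simpa [or_assoc] using this
      · exact Or.inr ⟨k₁ q, by simpa using h⟩

theorem special₂ (P Q : NodalDisk) (pre : List (P.D × Circle)) (z : P.D × Circle)
    (post : List (P.D × Circle)) :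
    ∀ p : Q.D × Circle, ((b₂ p : (P.D ⊕ Q.D) × Circle) ∈
      b₁ P.out :: (pre.map b₁ ++ Q.inputs.map b₂ ++ post.map b₁) ∨
      ∃ q, glueNode P.node Q.node (bpt z) (bpt Q.out) (bpt (b₂ p)) q) ↔
      (p ∈ Q.out :: Q.inputs ∨ ∃ q, Q.node (bpt p) q) := by
    intro p
    rw [bpt_b₂]
    constructor
    · rintro (h | ⟨q, h⟩)
      · left
        have : p ∈ Q.inputs := by simpa using h
        simp [this]
      · induction q using pt_cases with
        | h₂ q => exact Or.inr ⟨q, by simpa using h⟩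
        | h₁ q =>
          have : p = Q.out := by simpa using (glueNode₂₁.1 h).1
          left; simp [this]
    · rintro (h | ⟨q, h⟩)
      · by_cases hpz : p = Q.out
        · exact Or.inr ⟨k₁ (bpt z), by simp [hpz]⟩
        · left
          have : p ∈ Q.inputs := by grind
          simp [this]
      · exact Or.inr ⟨k₂ q, by simpa using h⟩

/-- Gluing of nodal disks: the marked point `z₀` of `Q` is glued to the marked point `z` of `P`,
and the remaining inputs are listed in the induced order. -/
def NodalDisk.glue (P Q : NodalDisk) (pre : List (P.D × Circle)) (z : P.D × Circle)
    (post : List (P.D × Circle)) (hz : P.inputs = pre ++ z :: post) : NodalDisk where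
  D := P.D ⊕ Q.D
  S := P.S ⊕ Q.S
  finD := by have := P.finD; have := Q.finD; infer_instance
  finS := by have := P.finS; have := Q.finS; infer_instance
  node := glueNode P.node Q.node (bpt z) (bpt Q.out)
  out := b₁ P.out
  inputs := pre.map b₁ ++ Q.inputs.map b₂ ++ post.map b₁
  node_symm := by
    intro p q
    induction p using pt_cases <;> induction q using pt_cases
    · simpa using P.node_symm
    · simpa using fun h1 h2 => ⟨h2, h1⟩
    · simpa using fun h1 h2 => ⟨h2, h1⟩
    · simpa using Q.node_symm
  node_ne := by
    intro p q
    induction p using pt_cases <;> induction q using pt_cases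
    · simpa [cpt_k₁, c₁_inj] using P.node_ne
    · intro _; rw [cpt_k₁, cpt_k₂]; exact c₁_ne_c₂
    · intro _; rw [cpt_k₁, cpt_k₂]; exact c₁_ne_c₂.symm
    · simpa [cpt_k₂, c₂_inj] using Q.node_ne
  node_unique := by
    have hP : ∀ q, ¬ P.node (bpt z) q := P.not_node z (by simp [hz])
    have hQ : ∀ q, ¬ Q.node (bpt Q.out) q := Q.not_node _ (by simp)
    have hP' : ∀ q, ¬ P.node q (bpt z) := fun q h => hP q (P.node_symm h)
    have hQ' : ∀ q, ¬ Q.node q (bpt Q.out) := fun q h => hQ q (Q.node_symm h)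
    have u1 := @P.node_unique
    have u2 := @Q.node_unique
    intro p q q' h h'
    induction p using pt_cases <;> induction q using pt_cases <;> induction q' using pt_cases <;>
      simp only [glueNode₁₁, glueNode₁₂, glueNode₂₁, glueNode₂₂, k₁_inj, k₂_inj, k₁_ne_k₂,
        k₂_ne_k₁] at h h' ⊢ <;> grind
  node_pair := by
    have u1 := @P.node_pair
    have u2 := @Q.node_pair
    intro p q p' q' h h' hp hq
    induction p using pt_cases <;> induction q using pt_cases <;> induction p' using pt_cases <;>
      induction q' using pt_cases <;>
      simp only [glueNode₁₁, glueNode₁₂, glueNode₂₁, glueNode₂₂, k₁_inj, k₂_inj, cpt_k₁, cpt_k₂, c₁_inj, c₂_inj, c₁_ne_c₂, c₁_ne_c₂.symm] at h h' hp hq ⊢ <;> grind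
  node_bdry := by
    have u1 := @P.node_bdry
    have u2 := @Q.node_bdry
    intro p q h hp
    induction p using pt_cases <;> induction q using pt_cases <;>
      simp only [glueNode₁₁, glueNode₁₂, glueNode₂₁, glueNode₂₂, isBdry_k₁, isBdry_k₂]
        at h hp ⊢
    · exact u1 h hp
    · exact h.2 ▸ ⟨_, rfl⟩
    · exact h.2 ▸ ⟨_, rfl⟩
    · exact u2 h hp
  node_disks := by
    rintro ⟨i | i, x⟩ ⟨j | j, y⟩ h
    · exact isBdry_k₁.2 (P.node_disks (p := (i, x)) (q := (j, y)) (glueNode₁₁.1 h))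
    · have : (Sum.inl (i, x) : Pt P.D P.S) = bpt z := (glueNode₁₂ (b := Sum.inl (j, y)).1 h).1
      exact isBdry_k₁.2 ⟨_, this⟩
    · have : (Sum.inl (i, x) : Pt Q.D Q.S) = bpt Q.out :=
        (glueNode₂₁ (a := Sum.inl (j, y)).1 h).1
      exact isBdry_k₂.2 ⟨_, this⟩
    · exact isBdry_k₂.2 (Q.node_disks (p := (i, x)) (q := (j, y)) (glueNode₂₂.1 h))
  tree := by
    have := tree_join P.tree Q.tree (cpt (bpt z)) (cpt (bpt Q.out))
    refine (SimpleGraph.Iso.isTree_iff ⟨Equiv.sumSumSumComm _ _ _ _, ?_⟩).1 this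
    intro a b
    exact dualGraph_glue a b
  disks_connected := by
    refine connected_join P.disks_connected Q.disks_connected (a := z.1) (b := Q.out.1) ?_ ?_ ?_
    · intro x y h
      have := (dualGraph_glue (n₁ := P.node) (n₂ := Q.node) (z := bpt z) (w := bpt Q.out)
        (Sum.inl (Sum.inl x)) (Sum.inl (Sum.inl y))).2 (Or.inl (by simpa using h))
      exact this
    · intro x y h
      have := (dualGraph_glue (n₁ := P.node) (n₂ := Q.node) (z := bpt z) (w := bpt Q.out)
        (Sum.inr (Sum.inl x)) (Sum.inr (Sum.inl y))).2 (Or.inl (by simpa using h))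
      exact this
    · have := (dualGraph_glue (n₁ := P.node) (n₂ := Q.node) (z := bpt z) (w := bpt Q.out)
        (Sum.inl (cpt (bpt z))) (Sum.inr (cpt (bpt Q.out)))).2
        (Or.inr (by simp [SimpleGraph.edge_adj]))
      exact this
  nodup := by
    have h1 := P.nodup
    have h2 := Q.nodup
    rw [hz] at h1
    have : b₁ P.out :: (pre.map b₁ ++ Q.inputs.map b₂ ++ post.map b₁ : List ((P.D ⊕ Q.D) × Circle))
      = (P.out :: pre).map b₁ ++ Q.inputs.map b₂ ++ post.map b₁ := by simp
    rw [this]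
    have h3 : ((P.out :: pre) ++ post).Nodup := by grind
    have h4 : Q.inputs.Nodup := by grind
    rw [List.nodup_append] at h3
    rw [List.nodup_append, List.nodup_append]
    refine ⟨⟨h3.1.map b₁_injective, h4.map b₂_injective, ?_⟩, h3.2.1.map b₁_injective, ?_⟩
    · intro x hx y hy
      obtain ⟨x, -, rfl⟩ := List.mem_map.1 hx
      obtain ⟨y, -, rfl⟩ := List.mem_map.1 hy
      exact b₁_ne_b₂
    · intro x hx y hy
      obtain ⟨y, hy', rfl⟩ := List.mem_map.1 hy
      rcases List.mem_append.1 hx with hx | hx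
      · obtain ⟨x, hx', rfl⟩ := List.mem_map.1 hx
        exact fun h => h3.2.2 x hx' y hy' (b₁_injective h)
      · obtain ⟨x, hx, rfl⟩ := List.mem_map.1 hx
        exact b₂_ne_b₁
  not_node := by
    have h1 := P.nodup
    have h2 := Q.nodup
    have h3 := P.not_node
    have h4 := Q.not_node
    rw [hz] at h1 h3
    intro p hp q
    induction p using b_cases with
    | h₁ p =>
      have hp' : p ∈ P.out :: (pre ++ z :: post) ∧ p ≠ z := by
        have : p = P.out ∨ p ∈ pre ∨ p ∈ post := by simpa [or_assoc] using hp
        grind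
      rw [bpt_b₁]
      induction q using pt_cases with
      | h₁ q => simpa using h3 p hp'.1 q
      | h₂ q => simpa using fun h => absurd h hp'.2
    | h₂ p =>
      have hp' : p ∈ Q.out :: Q.inputs ∧ p ≠ Q.out := by
        have : p ∈ Q.inputs := by simpa using hp
        grind
      rw [bpt_b₂]
      induction q using pt_cases with
      | h₁ q => simpa using fun h => absurd h hp'.2
      | h₂ q => simpa using h4 p hp'.1 q
  order := by
    have s1 := special₁ P Q pre z post hz
    have s2 := special₂ P Q pre z post
    have m1 := fun (p q : P.D × Circle) (h : Reach (fun p => p ∈ P.out :: P.inputs ∨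
      ∃ q, P.node (bpt p) q) (fun p q => P.node (bpt p) (bpt q)) p q) => h.map
      (sp' := fun p => p ∈ b₁ P.out :: (pre.map b₁ ++ Q.inputs.map b₂ ++ post.map b₁) ∨
        ∃ q, glueNode P.node Q.node (bpt z) (bpt Q.out) (bpt p) q)
      (nd' := fun p q => glueNode P.node Q.node (bpt z) (bpt Q.out) (bpt p) (bpt q)) Sum.inl s1
      (fun p q h => glueNode₁₁ (a := bpt p) (b := bpt q).2 h)
    have m2 := fun (p q : Q.D × Circle) (h : Reach (fun p => p ∈ Q.out :: Q.inputs ∨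
      ∃ q, Q.node (bpt p) q) (fun p q => Q.node (bpt p) (bpt q)) p q) => h.map
      (sp' := fun p => p ∈ b₁ P.out :: (pre.map b₁ ++ Q.inputs.map b₂ ++ post.map b₁) ∨
        ∃ q, glueNode P.node Q.node (bpt z) (bpt Q.out) (bpt p) q)
      (nd' := fun p q => glueNode P.node Q.node (bpt z) (bpt Q.out) (bpt p) (bpt q)) Sum.inr s2
      (fun p q h => glueNode₂₂ (a := bpt p) (b := bpt q).2 h)
    have n12 : glueNode P.node Q.node (bpt z) (bpt Q.out) (bpt (b₁ z)) (bpt (b₂ Q.out)) := by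
      simp [bpt_b₁, bpt_b₂]
    have n21 : glueNode P.node Q.node (bpt z) (bpt Q.out) (bpt (b₂ Q.out)) (bpt (b₁ z)) := by
      simp [bpt_b₁, bpt_b₂]
    have hc := P.order
    have e : P.out :: P.inputs ++ [P.out] = (P.out :: pre) ++ z :: (post ++ [P.out]) := by
      simp [hz]
    rw [e] at hc
    have := chain_glue (f := b₁) (g := b₂) m1 m2
      (fun a b h h' => (m1 _ _ h).trans (m2 _ _ h') n12)
      (fun a b h h' => (m2 _ _ h).trans (m1 _ _ h') n21)
      (fun a b h h' h'' => ((m1 _ _ h).trans (m2 _ _ h') n12).trans (m1 _ _ h'') n21)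
      (by simp) hc Q.order
    simpa using this

/-! ### Boundary values and isomorphisms of polygons -/

/-- The fibre product `L ×_X L`. -/
abbrev FibProd {X : Type u} {L : Type v} (ι : L → X) : Type v := {p : L × L // ι p.1 = ι p.2}

/-- The directed graph of `ι : L → X`: vertices are the connected components of `L`, edges are the
points `(p₁, p₂)` of `L ×_X L`, from the component of `p₁` to that of `p₂`. -/
def immersionGraph {X : Type u} {L : Type v} [TopologicalSpace L] (ι : L → X) : DirGraph.{v} where
  V := ConnectedComponents L
  E := FibProd ι
  s e := ConnectedComponents.mk e.1.1
  t e := ConnectedComponents.mk e.1.2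

section Polygons

variable {E : Type*} [NormedAddCommGroup E] [NormedSpace ℝ E] {X : Type u} [TopologicalSpace X]
  [ChartedSpace E X] {L : Type v} [TopologicalSpace L]
  {J : ∀ x : X, TangentSpace 𝓘(ℝ, E) x →L[ℝ] TangentSpace 𝓘(ℝ, E) x} {ι : L → X}

/-- The evaluation `(γ(z-), γ(z+))` at an input marked point. -/
def Polygon.ev (P : Polygon J ι) (p : P.D × Circle) : FibProd ι :=
  ⟨(P.γm p, P.γp p), (P.ι_γm p).trans (P.ι_γp p).symm⟩

/-- The evaluation `(γ(z₀+), γ(z₀-))` at the output marked point. -/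
def Polygon.evOut (P : Polygon J ι) : FibProd ι :=
  ⟨(P.γp P.out, P.γm P.out), (P.ι_γp _).trans (P.ι_γm _).symm⟩

theorem Polygon.arc_component (P : Polygon J ι) {p q : P.D × Circle} (h : Arc P.Special p q) :
    ConnectedComponents.mk (P.γp p) = ConnectedComponents.mk (P.γm q) := by
  obtain ⟨θ, hθ, -, rfl, -, hns⟩ := h
  set g : ℝ → L := fun t => P.γp (p.1, p.2 * Circle.exp t) with hg
  have hpre : IsPreconnected (g '' Ioo 0 θ) := by
    refine isPreconnected_Ioo.image _ fun t ht => ContinuousAt.continuousWithinAt ?_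
    have e : ∀ s, (p.1, p.2 * Circle.exp t * Circle.exp (s - t)) = (p.1, p.2 * Circle.exp s) := by
      intro s
      rw [mul_assoc, ← Circle.exp_add, add_sub_cancel]
    have eq0 := P.γ_eq _ (hns t ht.1 ht.2)
    have hsub : Continuous fun s : ℝ => s - t := by fun_prop
    rw [continuousAt_iff_continuous_left'_right']
    constructor
    · have h1 := P.γm_lim (p.1, p.2 * Circle.exp t)
      have h2 : Tendsto (fun s : ℝ => s - t) (𝓝[<] t) (𝓝[<] 0) := by
        refine tendsto_nhdsWithin_iff.2 ⟨?_, ?_⟩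
        · have := (hsub.tendsto t).mono_left (nhdsWithin_le_nhds (s := Iio t))
          simpa using this
        · filter_upwards [self_mem_nhdsWithin] with s hs
          simpa using hs
      have h3 := h1.comp h2
      rw [eq0] at h3
      refine Tendsto.congr' ?_ h3
      filter_upwards [Ioo_mem_nhdsLT ht.1] with s hs
      simp only [Function.comp, e, hg]
      exact P.γ_eq _ (hns s hs.1 (hs.2.trans ht.2))
    · have h1 := P.γp_lim (p.1, p.2 * Circle.exp t)
      have h2 : Tendsto (fun s : ℝ => s - t) (𝓝[>] t) (𝓝[>] 0) := by
        refine tendsto_nhdsWithin_iff.2 ⟨?_, ?_⟩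
        · have := (hsub.tendsto t).mono_left (nhdsWithin_le_nhds (s := Ioi t))
          simpa using this
        · filter_upwards [self_mem_nhdsWithin] with s hs
          simpa using hs
      have h3 := h1.comp h2
      refine Tendsto.congr (fun s => ?_) h3
      simp only [Function.comp, e, hg]
  have hp : P.γp p ∈ closure (g '' Ioo 0 θ) := by
    refine mem_closure_of_tendsto (P.γp_lim p) ?_
    filter_upwards [Ioo_mem_nhdsGT hθ] with s hs
    exact ⟨s, hs, rfl⟩
  have hq : P.γm (p.1, p.2 * Circle.exp θ) ∈ closure (g '' Ioo 0 θ) := by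
    refine mem_closure_of_tendsto (P.γm_lim (p.1, p.2 * Circle.exp θ)) ?_
    filter_upwards [Ioo_mem_nhdsLT (neg_lt_zero.2 hθ)] with s hs
    have h0 : 0 < θ + s := by linarith [hs.1]
    have h1 : θ + s < θ := by linarith [hs.2]
    refine ⟨θ + s, ⟨h0, h1⟩, ?_⟩
    simp only [hg, mul_assoc, ← Circle.exp_add]
    exact (P.γ_eq _ (hns _ h0 h1)).symm
  rw [ConnectedComponents.coe_eq_coe']
  exact hpre.closure.subset_connectedComponent hq hp

theorem Polygon.reach_component (P : Polygon J ι) {p q : P.D × Circle}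
    (h : Reach P.Special (fun p q => P.node (bpt p) (bpt q)) p q) :
    ConnectedComponents.mk (P.γp p) = ConnectedComponents.mk (P.γm q) := by
  induction h with
  | arc h => exact P.arc_component h
  | cross _ h2 h3 ih => rw [ih, P.γ_node h2, P.arc_component h3]

theorem Polygon.profile (P : Polygon J ι) :
    (immersionGraph ι).IsProfileLoop (P.inputs.map P.ev) P.evOut := by
  have key : ∀ (l : List (P.D × Circle)) (x : P.D × Circle),
      List.IsChain (Reach P.Special fun p q => P.node (bpt p) (bpt q)) (x :: l ++ [P.out]) →
      (immersionGraph ι).IsPath (ConnectedComponents.mk (P.γp x)) (l.map P.ev)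
        (ConnectedComponents.mk (P.γm P.out)) := by
    intro l
    induction l with
    | nil =>
      intro x h
      simp only [List.cons_append, List.nil_append, List.isChain_cons_cons] at h
      exact P.reach_component h.1
    | cons a l ih =>
      intro x h
      simp only [List.cons_append, List.isChain_cons_cons] at h
      exact ⟨(P.reach_component h.1).symm, ih a h.2⟩
  exact key _ _ P.order

namespace Polygon.Iso

variable {P Q R : Polygon J ι}

/-- The identity. -/
protected def refl (P : Polygon J ι) : P.Iso P where
  σ := Equiv.refl _
  τ := Equiv.refl _
  φ := 1
  ψ := 1
  node_iff := by rintro (⟨_, _⟩ | ⟨_, _⟩) (⟨_, _⟩ | ⟨_, _⟩) <;> rfl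
  out_eq := rfl
  inputs_eq := List.map_id _
  u_eq := by rintro (⟨_, _⟩ | ⟨_, _⟩) <;> rfl
  γm_eq := fun _ => rfl
  γp_eq := fun _ => rfl

theorem mapPt_comp (f : P.Iso Q) (g : Q.Iso R) (p : Pt P.D P.S) :
    mapPt (f.σ.trans g.σ) (f.τ.trans g.τ) (fun i => g.φ (f.σ i) * f.φ i)
      (fun i => g.ψ (f.τ i) * f.ψ i) p = mapPt g.σ g.τ g.φ g.ψ (mapPt f.σ f.τ f.φ f.ψ p) := by
  rcases p with ⟨_, _⟩ | ⟨_, _⟩ <;> rfl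

/-- Composition. -/
protected def trans (f : P.Iso Q) (g : Q.Iso R) : P.Iso R where
  σ := f.σ.trans g.σ
  τ := f.τ.trans g.τ
  φ i := g.φ (f.σ i) * f.φ i
  ψ i := g.ψ (f.τ i) * f.ψ i
  node_iff p q := by rw [mapPt_comp, mapPt_comp, g.node_iff, f.node_iff]
  out_eq := by rw [← g.out_eq, ← f.out_eq]; rfl
  inputs_eq := by rw [← g.inputs_eq, ← f.inputs_eq, List.map_map]; rfl
  u_eq p := by rw [mapPt_comp, g.u_eq, f.u_eq]
  γm_eq p := (g.γm_eq _).trans (f.γm_eq p)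
  γp_eq p := (g.γp_eq _).trans (f.γp_eq p)

theorem mapPt_inv (f : P.Iso Q) (p : Pt Q.D Q.S) :
    mapPt f.σ f.τ f.φ f.ψ (mapPt f.σ.symm f.τ.symm (fun i => (f.φ (f.σ.symm i))⁻¹)
      (fun i => (f.ψ (f.τ.symm i))⁻¹) p) = p := by
  rcases p with ⟨i, x⟩ | ⟨i, x⟩
  · simp [mapPt]
  · simp [mapPt]

theorem mapB_inv (f : P.Iso Q) (p : P.D × Circle) :
    mapB f.σ.symm (fun i => (f.φ (f.σ.symm i))⁻¹) (mapB f.σ f.φ p) = p := by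
  have : ∀ (a : DiskAut) (x : Circle), onCircle a⁻¹ (onCircle a x) = x := fun a x => by
    rw [← onCircle_mul, inv_mul_cancel, onCircle_one]
  simp [mapB, this]

theorem mapB_inv' (f : P.Iso Q) (p : Q.D × Circle) :
    mapB f.σ f.φ (mapB f.σ.symm (fun i => (f.φ (f.σ.symm i))⁻¹) p) = p := by
  have : ∀ (a : DiskAut) (x : Circle), onCircle a (onCircle a⁻¹ x) = x := fun a x => by
    rw [← onCircle_mul, mul_inv_cancel, onCircle_one]
  simp [mapB, this]

/-- The inverse. -/
protected def symm (f : P.Iso Q) : Q.Iso P where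
  σ := f.σ.symm
  τ := f.τ.symm
  φ i := (f.φ (f.σ.symm i))⁻¹
  ψ i := (f.ψ (f.τ.symm i))⁻¹
  node_iff p q := by rw [← f.node_iff, mapPt_inv, mapPt_inv]
  out_eq := by rw [← f.out_eq, mapB_inv]
  inputs_eq := by
    rw [← f.inputs_eq, List.map_map]
    conv_rhs => rw [← List.map_id P.inputs]
    exact List.map_congr_left fun p _ => mapB_inv f p
  u_eq p := by rw [← f.u_eq, mapPt_inv]
  γm_eq p := by rw [← f.γm_eq, mapB_inv']
  γp_eq p := by rw [← f.γp_eq, mapB_inv']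

theorem ev_eq (f : P.Iso Q) (p : P.D × Circle) : Q.ev (mapB f.σ f.φ p) = P.ev p :=
  Subtype.ext (Prod.ext (f.γm_eq p) (f.γp_eq p))

theorem evOut_eq (f : P.Iso Q) : Q.evOut = P.evOut := by
  refine Subtype.ext (Prod.ext ?_ ?_)
  · change Q.γp Q.out = P.γp P.out
    rw [← f.out_eq, f.γp_eq]
  · change Q.γm Q.out = P.γm P.out
    rw [← f.out_eq, f.γm_eq]

theorem map_ev (f : P.Iso Q) : Q.inputs.map Q.ev = P.inputs.map P.ev := by
  rw [← f.inputs_eq, List.map_map]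
  exact List.map_congr_left fun p _ => f.ev_eq p

end Polygon.Iso

/-- Gluing of polygons: the output of `Q` is glued to the input `z` of `P`. -/
def Polygon.glue (P Q : Polygon J ι) (pre : List (P.D × Circle)) (z : P.D × Circle)
    (post : List (P.D × Circle)) (hz : P.inputs = pre ++ z :: post) (hm : P.ev z = Q.evOut) :
    Polygon J ι where
  toNodalDisk := P.toNodalDisk.glue Q.toNodalDisk pre z post hz
  uD := Sum.elim P.uD Q.uD
  uS := Sum.elim P.uS Q.uS
  γm p := Sum.elim (fun i => P.γm (i, p.2)) (fun i => Q.γm (i, p.2)) p.1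
  γp p := Sum.elim (fun i => P.γp (i, p.2)) (fun i => Q.γp (i, p.2)) p.1
  uD_cont := by rintro (i | i); exacts [P.uD_cont i, Q.uD_cont i]
  uD_hol := by rintro (i | i); exacts [P.uD_hol i, Q.uD_hol i]
  uS_hol := by rintro (i | i); exacts [P.uS_hol i, Q.uS_hol i]
  uS_hol_inv := by rintro (i | i); exacts [P.uS_hol_inv i, Q.uS_hol_inv i]
  u_node := by
    have h : P.u (bpt z) = Q.u (bpt Q.out) := by
      refine (P.ι_γm z).symm.trans (Eq.trans ?_ (Q.ι_γp Q.out))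
      exact congrArg (fun e : FibProd ι => ι e.1.1) hm
    have e1 : ∀ p, evalPt (Sum.elim P.uD Q.uD) (Sum.elim P.uS Q.uS) (k₁ p) = P.u p := by
      rintro (⟨_, _⟩ | ⟨_, _⟩) <;> rfl
    have e2 : ∀ p, evalPt (Sum.elim P.uD Q.uD) (Sum.elim P.uS Q.uS) (k₂ p) = Q.u p := by
      rintro (⟨_, _⟩ | ⟨_, _⟩) <;> rfl
    intro p q hpq
    change glueNode P.node Q.node (bpt z) (bpt Q.out) p q at hpq
    induction p using pt_cases <;> induction q using pt_cases <;>
      simp only [glueNode₁₁, glueNode₁₂, glueNode₂₁, glueNode₂₂] at hpq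
    · exact (e1 _).trans ((P.u_node hpq).trans (e1 _).symm)
    · exact (e1 _).trans ((hpq.1 ▸ hpq.2 ▸ h).trans (e2 _).symm)
    · exact (e2 _).trans ((hpq.1 ▸ hpq.2 ▸ h.symm).trans (e1 _).symm)
    · exact (e2 _).trans ((Q.u_node hpq).trans (e2 _).symm)
  ι_γm := by rintro ⟨i | i, a⟩; exacts [P.ι_γm (i, a), Q.ι_γm (i, a)]
  ι_γp := by rintro ⟨i | i, a⟩; exacts [P.ι_γp (i, a), Q.ι_γp (i, a)]
  γ_eq := by
    rintro ⟨i | i, a⟩ h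
    · exact P.γ_eq (i, a) fun h' =>
        h ((special₁ P.toNodalDisk Q.toNodalDisk pre z post hz (i, a)).2 h')
    · exact Q.γ_eq (i, a) fun h' =>
        h ((special₂ P.toNodalDisk Q.toNodalDisk pre z post (i, a)).2 h')
  γm_lim := by rintro ⟨i | i, a⟩; exacts [P.γm_lim (i, a), Q.γm_lim (i, a)]
  γp_lim := by rintro ⟨i | i, a⟩; exacts [P.γp_lim (i, a), Q.γp_lim (i, a)]
  γ_node := by
    have h1 : P.γm z = Q.γp Q.out := congrArg (fun e : FibProd ι => e.1.1) hm
    have h2 : P.γp z = Q.γm Q.out := congrArg (fun e : FibProd ι => e.1.2) hm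
    intro p q hpq
    change glueNode P.node Q.node (bpt z) (bpt Q.out) (bpt p) (bpt q) at hpq
    induction p using b_cases <;> induction q using b_cases <;>
      simp only [bpt_b₁, bpt_b₂, glueNode₁₁, glueNode₁₂, glueNode₂₁, glueNode₂₂, bpt_inj] at hpq
    · exact P.γ_node hpq
    · obtain ⟨rfl, rfl⟩ := hpq
      exact h1
    · obtain ⟨rfl, rfl⟩ := hpq
      exact h2.symm
    · exact Q.γ_node hpq

theorem map_three {α β γ δ : Type*} (f : α → γ) (g : β → γ) (h : γ → δ) (l₁ : List α) (l₂ : List β)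
    (l₃ : List α) : (l₁.map f ++ l₂.map g ++ l₃.map f).map h =
      l₁.map (h ∘ f) ++ l₂.map (h ∘ g) ++ l₃.map (h ∘ f) := by
  simp

theorem Polygon.glue_map_ev (P Q : Polygon J ι) (pre : List (P.D × Circle)) (z : P.D × Circle)
    (post : List (P.D × Circle)) (hz : P.inputs = pre ++ z :: post) (hm : P.ev z = Q.evOut) :
    (P.glue Q pre z post hz hm).inputs.map (P.glue Q pre z post hz hm).ev =
      pre.map P.ev ++ Q.inputs.map Q.ev ++ post.map P.ev := by
  exact map_three b₁ b₂ (P.glue Q pre z post hz hm).ev pre Q.inputs post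

theorem mapPt_glue {D₁ D₂ S₁ S₂ D₃ D₄ S₃ S₄ : Type} (σ : D₁ → D₃) (σ' : D₂ → D₄) (τ : S₁ → S₃)
    (τ' : S₂ → S₄) (φ : D₁ → DiskAut) (φ' : D₂ → DiskAut) (ψ : S₁ → SphereAut)
    (ψ' : S₂ → SphereAut) :
    (∀ p : Pt D₁ S₁, mapPt (Sum.map σ σ') (Sum.map τ τ') (Sum.elim φ φ') (Sum.elim ψ ψ') (k₁ p) =
      k₁ (mapPt σ τ φ ψ p)) ∧
    (∀ p : Pt D₂ S₂, mapPt (Sum.map σ σ') (Sum.map τ τ') (Sum.elim φ φ') (Sum.elim ψ ψ') (k₂ p) =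
      k₂ (mapPt σ' τ' φ' ψ' p)) := by
  constructor <;> rintro (⟨_, _⟩ | ⟨_, _⟩) <;> rfl

theorem Polygon.Iso.mapPt_injective {P Q : Polygon J ι} (f : P.Iso Q) :
    Function.Injective (mapPt f.σ f.τ f.φ f.ψ) := by
  rintro (⟨i, x⟩ | ⟨i, x⟩) (⟨j, y⟩ | ⟨j, y⟩) h
  · simp only [mapPt, Sum.inl.injEq, Prod.mk.injEq, EmbeddingLike.apply_eq_iff_eq] at h
    obtain ⟨rfl, h⟩ := h
    rw [(f.φ i).1.injective h]
  · simp [mapPt] at h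
  · simp [mapPt] at h
  · simp only [mapPt, Sum.inr.injEq, Prod.mk.injEq, EmbeddingLike.apply_eq_iff_eq] at h
    obtain ⟨rfl, h⟩ := h
    rw [(f.ψ i).1.injective h]

/-- Isomorphisms of the pieces induce an isomorphism of the glued polygons. -/
def Polygon.glueIso {P Q P' Q' : Polygon J ι} (f : P.Iso P') (g : Q.Iso Q')
    {pre : List (P.D × Circle)} {z : P.D × Circle} {post : List (P.D × Circle)}
    {hz : P.inputs = pre ++ z :: post} {hm : P.ev z = Q.evOut}
    {pre' : List (P'.D × Circle)} {z' : P'.D × Circle} {post' : List (P'.D × Circle)}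
    {hz' : P'.inputs = pre' ++ z' :: post'} {hm' : P'.ev z' = Q'.evOut}
    (h₁ : pre.map (mapB f.σ f.φ) = pre') (h₂ : mapB f.σ f.φ z = z')
    (h₃ : post.map (mapB f.σ f.φ) = post') :
    (P.glue Q pre z post hz hm).Iso (P'.glue Q' pre' z' post' hz' hm') where
  σ := Equiv.sumCongr f.σ g.σ
  τ := Equiv.sumCongr f.τ g.τ
  φ := Sum.elim f.φ g.φ
  ψ := Sum.elim f.ψ g.ψ
  node_iff p q := by
    obtain ⟨e1, e2⟩ := mapPt_glue f.σ g.σ f.τ g.τ f.φ g.φ f.ψ g.ψ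
    change glueNode P'.node Q'.node (bpt z') (bpt Q'.out)
      (mapPt (Sum.map f.σ g.σ) (Sum.map f.τ g.τ) (Sum.elim f.φ g.φ) (Sum.elim f.ψ g.ψ) p)
      (mapPt (Sum.map f.σ g.σ) (Sum.map f.τ g.τ) (Sum.elim f.φ g.φ) (Sum.elim f.ψ g.ψ) q) ↔
      glueNode P.node Q.node (bpt z) (bpt Q.out) p q
    induction p using pt_cases <;> induction q using pt_cases <;>
      simp only [e1, e2, glueNode₁₁, glueNode₁₂, glueNode₂₁, glueNode₂₂, ← h₂, ← g.out_eq,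
        ← mapPt_bpt f.σ f.τ f.φ f.ψ, ← mapPt_bpt g.σ g.τ g.φ g.ψ, f.node_iff, g.node_iff,
        f.mapPt_injective.eq_iff, g.mapPt_injective.eq_iff]
  out_eq := congrArg b₁ f.out_eq
  inputs_eq := by
    have e : pre'.map b₁ ++ Q'.inputs.map b₂ ++ post'.map b₁ =
        pre.map ((b₁ : P'.D × Circle → (P'.D ⊕ Q'.D) × Circle) ∘ mapB f.σ f.φ) ++
          Q.inputs.map (b₂ ∘ mapB g.σ g.φ) ++ post.map (b₁ ∘ mapB f.σ f.φ) := by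
      rw [← List.map_map, ← List.map_map, ← List.map_map, h₁, h₃, g.inputs_eq]
    exact (map_three b₁ b₂ (mapB (Sum.map f.σ g.σ) (Sum.elim f.φ g.φ)) pre Q.inputs post).trans
      e.symm
  u_eq := by
    rintro (⟨i | i, x⟩ | ⟨i | i, x⟩)
    · exact f.u_eq (Sum.inl (i, x))
    · exact g.u_eq (Sum.inl (i, x))
    · exact f.u_eq (Sum.inr (i, x))
    · exact g.u_eq (Sum.inr (i, x))
  γm_eq := by rintro ⟨i | i, x⟩; exacts [f.γm_eq (i, x), g.γm_eq (i, x)]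
  γp_eq := by rintro ⟨i | i, x⟩; exacts [f.γp_eq (i, x), g.γp_eq (i, x)]

section Stable

variable {P Q : Polygon J ι} {pre : List (P.D × Circle)} {z : P.D × Circle}
  {post : List (P.D × Circle)} {hz : P.inputs = pre ++ z :: post} {hm : P.ev z = Q.evOut}

/-- An automorphism of a glued polygon that preserves every component restricts to the pieces. -/
def Polygon.Iso.restrict (f : (P.glue Q pre z post hz hm).Iso (P.glue Q pre z post hz hm))
    (hσ : f.σ = Equiv.refl _) (hτ : f.τ = Equiv.refl _) : P.Iso P × Q.Iso Q := by
  obtain ⟨σ, τ, φ, ψ, hn, ho, hi, hu, hγm, hγp⟩ := f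
  dsimp only at hσ hτ
  subst hσ hτ
  let φ₁ : P.D → DiskAut := fun i => φ (Sum.inl i)
  let φ₂ : Q.D → DiskAut := fun i => φ (Sum.inr i)
  let ψ₁ : P.S → SphereAut := fun i => ψ (Sum.inl i)
  let ψ₂ : Q.S → SphereAut := fun i => ψ (Sum.inr i)
  have e1 : ∀ p : Pt P.D P.S, mapPt (Equiv.refl (P.D ⊕ Q.D)) (Equiv.refl (P.S ⊕ Q.S)) φ ψ (k₁ p) =
      k₁ (mapPt (Equiv.refl _) (Equiv.refl _) φ₁ ψ₁ p) := by
    rintro (⟨_, _⟩ | ⟨_, _⟩) <;> rfl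
  have e2 : ∀ p : Pt Q.D Q.S, mapPt (Equiv.refl (P.D ⊕ Q.D)) (Equiv.refl (P.S ⊕ Q.S)) φ ψ (k₂ p) =
      k₂ (mapPt (Equiv.refl _) (Equiv.refl _) φ₂ ψ₂ p) := by
    rintro (⟨_, _⟩ | ⟨_, _⟩) <;> rfl
  have hn' : ∀ p q : Pt (P.D ⊕ Q.D) (P.S ⊕ Q.S),
    glueNode P.node Q.node (bpt z) (bpt Q.out)
      (mapPt (Equiv.refl (P.D ⊕ Q.D)) (Equiv.refl (P.S ⊕ Q.S)) φ ψ p)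
      (mapPt (Equiv.refl (P.D ⊕ Q.D)) (Equiv.refl (P.S ⊕ Q.S)) φ ψ q) ↔
      glueNode P.node Q.node (bpt z) (bpt Q.out) p q := hn
  have n11 : ∀ p q, P.node (mapPt (Equiv.refl _) (Equiv.refl _) φ₁ ψ₁ p)
      (mapPt (Equiv.refl _) (Equiv.refl _) φ₁ ψ₁ q) ↔ P.node p q := fun p q => by
    have := hn' (k₁ p) (k₁ q)
    rwa [e1, e1, glueNode₁₁, glueNode₁₁] at this
  have n22 : ∀ p q, Q.node (mapPt (Equiv.refl _) (Equiv.refl _) φ₂ ψ₂ p)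
      (mapPt (Equiv.refl _) (Equiv.refl _) φ₂ ψ₂ q) ↔ Q.node p q := fun p q => by
    have := hn' (k₂ p) (k₂ q)
    rwa [e2, e2, glueNode₂₂, glueNode₂₂] at this
  have n12 : mapB (Equiv.refl _) φ₁ z = z ∧ mapB (Equiv.refl _) φ₂ Q.out = Q.out := by
    have := (hn' (k₁ (bpt z)) (k₂ (bpt Q.out))).2 (by simp)
    rw [e1, e2, glueNode₁₂, mapPt_bpt, mapPt_bpt, bpt_inj, bpt_inj] at this
    exact this
  have hi' : List.map (mapB (Equiv.refl (P.D ⊕ Q.D)) φ)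
      (pre.map b₁ ++ Q.inputs.map b₂ ++ post.map b₁) =
      pre.map b₁ ++ Q.inputs.map b₂ ++ post.map b₁ := hi
  have hfix : ∀ p ∈ (pre.map b₁ ++ Q.inputs.map b₂ ++ post.map b₁ : List ((P.D ⊕ Q.D) × Circle)),
      mapB (Equiv.refl (P.D ⊕ Q.D)) φ p = p := by
    conv_rhs at hi' => rw [← List.map_id (pre.map b₁ ++ Q.inputs.map b₂ ++ post.map b₁)]
    exact List.map_inj_left.1 hi'
  have f1 : ∀ p ∈ P.inputs, mapB (Equiv.refl P.D) φ₁ p = p := by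
    intro p hp
    rw [hz] at hp
    by_cases hpz : p = z
    · rw [hpz]; exact n12.1
    · refine b₁_injective (D' := Q.D) (hfix (b₁ p) ?_)
      have : p ∈ pre ∨ p ∈ post := by grind
      simpa using this
  have f2 : ∀ p ∈ Q.inputs, mapB (Equiv.refl Q.D) φ₂ p = p := fun p hp =>
    b₂_injective (D := P.D) (hfix (b₂ p) (by simp [hp]))
  refine ⟨⟨Equiv.refl _, Equiv.refl _, φ₁, ψ₁, n11, b₁_injective (D' := Q.D) ho, ?_, ?_, ?_, ?_⟩,
    ⟨Equiv.refl _, Equiv.refl _, φ₂, ψ₂, n22, n12.2, ?_, ?_, ?_, ?_⟩⟩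
  · conv_rhs => rw [← List.map_id P.inputs]
    exact List.map_congr_left f1
  · rintro (⟨i, x⟩ | ⟨i, x⟩)
    · exact hu (Sum.inl (Sum.inl i, x))
    · exact hu (Sum.inr (Sum.inl i, x))
  · exact fun p => hγm (b₁ p)
  · exact fun p => hγp (b₁ p)
  · conv_rhs => rw [← List.map_id Q.inputs]
    exact List.map_congr_left f2
  · rintro (⟨i, x⟩ | ⟨i, x⟩)
    · exact hu (Sum.inl (Sum.inr i, x))
    · exact hu (Sum.inr (Sum.inr i, x))
  · exact fun p => hγm (b₂ p)
  · exact fun p => hγp (b₂ p)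

theorem Polygon.Iso.restrict_inj
    {f g : (P.glue Q pre z post hz hm).Iso (P.glue Q pre z post hz hm)}
    (hσ : f.σ = Equiv.refl _) (hτ : f.τ = Equiv.refl _) (hσ' : g.σ = Equiv.refl _)
    (hτ' : g.τ = Equiv.refl _) (h : f.restrict hσ hτ = g.restrict hσ' hτ') :
    f.φ = g.φ ∧ f.ψ = g.ψ := by
  obtain ⟨σ, τ, φ, ψ, hn, ho, hi, hu, hγm, hγp⟩ := f
  obtain ⟨σ', τ', φ', ψ', hn', ho', hi', hu', hγm', hγp'⟩ := g
  dsimp only at hσ hτ hσ' hτ'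
  subst hσ hτ hσ' hτ'
  constructor
  · funext i
    rcases i with i | i
    · exact congrFun (congrArg (fun x => x.1.φ) h) i
    · exact congrFun (congrArg (fun x => x.2.φ) h) i
  · funext i
    rcases i with i | i
    · exact congrFun (congrArg (fun x => x.1.ψ) h) i
    · exact congrFun (congrArg (fun x => x.2.ψ) h) i

theorem Polygon.glue_stable [Finite (P.Iso P)] [Finite (Q.Iso Q)] :
    Finite ((P.glue Q pre z post hz hm).Iso (P.glue Q pre z post hz hm)) := by
  classical
  set R := P.glue Q pre z post hz hm with hR
  have : Finite R.D := R.finD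
  have : Finite R.S := R.finS
  let K := Equiv.Perm R.D × Equiv.Perm R.S
  let key : R.Iso R → K := fun f => (f.σ, f.τ)
  let base : K → R.Iso R := fun k => if h : ∃ f, key f = k then h.choose else Polygon.Iso.refl R
  have hbase : ∀ f, key (base (key f)) = key f := fun f => by
    have h : ∃ g, key g = key f := ⟨f, rfl⟩
    simp only [base, dif_pos h]
    exact h.choose_spec
  let N : R.Iso R → R.Iso R := fun f => f.trans (base (key f)).symm
  have hNσ : ∀ f, (N f).σ = Equiv.refl _ := fun f => by
    have : (base (key f)).σ = f.σ := congrArg Prod.fst (hbase f)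
    change f.σ.trans (base (key f)).σ.symm = _
    rw [this, Equiv.self_trans_symm]
  have hNτ : ∀ f, (N f).τ = Equiv.refl _ := fun f => by
    have : (base (key f)).τ = f.τ := congrArg Prod.snd (hbase f)
    change f.τ.trans (base (key f)).τ.symm = _
    rw [this, Equiv.self_trans_symm]
  let F : R.Iso R → K × (P.Iso P × Q.Iso Q) := fun f => (key f, (N f).restrict (hNσ f) (hNτ f))
  refine Finite.of_injective F fun f g h => ?_
  have h1 : key f = key g := congrArg Prod.fst h
  have h2 := Polygon.Iso.restrict_inj (hNσ f) (hNτ f) (hNσ g) (hNτ g) (congrArg Prod.snd h)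
  have hs : f.σ = g.σ := congrArg Prod.fst h1
  have ht : f.τ = g.τ := congrArg Prod.snd h1
  refine Polygon.Iso.ext hs ht ?_ ?_
  · funext i
    have := congrFun h2.1 i
    simp only [N, Polygon.Iso.trans, h1, hs] at this
    exact mul_left_cancel this
  · funext i
    have := congrFun h2.2 i
    simp only [N, Polygon.Iso.trans, h1, ht] at this
    exact mul_left_cancel this

end Stable

section Assoc

theorem pt_cases₃ {D₁ D₂ D₃ S₁ S₂ S₃ : Type}
    {C : Pt ((D₁ ⊕ D₂) ⊕ D₃) ((S₁ ⊕ S₂) ⊕ S₃) → Prop} (h₁ : ∀ p, C (k₁ (k₁ p)))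
    (h₂ : ∀ p, C (k₁ (k₂ p))) (h₃ : ∀ p, C (k₂ p)) : ∀ p, C p :=
  pt_cases (pt_cases h₁ h₂) h₃

/-- Exchange of the second and third summand. -/
def swapSum (D₁ D₂ D₃ : Type) : (D₁ ⊕ D₂) ⊕ D₃ ≃ (D₁ ⊕ D₃) ⊕ D₂ :=
  ((Equiv.sumAssoc D₁ D₂ D₃).trans (Equiv.sumCongr (Equiv.refl _) (Equiv.sumComm _ _))).trans
    (Equiv.sumAssoc D₁ D₃ D₂).symm

theorem mapPt_assoc {D₁ D₂ D₃ S₁ S₂ S₃ : Type} :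
    (∀ p : Pt D₁ S₁, mapPt (Equiv.sumAssoc D₁ D₂ D₃) (Equiv.sumAssoc S₁ S₂ S₃) 1 1 (k₁ (k₁ p)) =
      k₁ p) ∧
    (∀ p : Pt D₂ S₂, mapPt (Equiv.sumAssoc D₁ D₂ D₃) (Equiv.sumAssoc S₁ S₂ S₃) 1 1 (k₁ (k₂ p)) =
      k₂ (k₁ p)) ∧
    (∀ p : Pt D₃ S₃, mapPt (Equiv.sumAssoc D₁ D₂ D₃) (Equiv.sumAssoc S₁ S₂ S₃) 1 1 (k₂ p) =
      k₂ (k₂ p)) := by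
  refine ⟨?_, ?_, ?_⟩ <;> rintro (⟨_, _⟩ | ⟨_, _⟩) <;> rfl

theorem mapPt_swap {D₁ D₂ D₃ S₁ S₂ S₃ : Type} :
    (∀ p : Pt D₁ S₁, mapPt (swapSum D₁ D₂ D₃) (swapSum S₁ S₂ S₃) 1 1 (k₁ (k₁ p)) =
      k₁ (k₁ p)) ∧
    (∀ p : Pt D₂ S₂, mapPt (swapSum D₁ D₂ D₃) (swapSum S₁ S₂ S₃) 1 1 (k₁ (k₂ p)) =
      k₂ p) ∧
    (∀ p : Pt D₃ S₃, mapPt (swapSum D₁ D₂ D₃) (swapSum S₁ S₂ S₃) 1 1 (k₂ p) =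
      k₁ (k₂ p)) := by
  refine ⟨?_, ?_, ?_⟩ <;> rintro (⟨_, _⟩ | ⟨_, _⟩) <;> rfl

theorem glueNode_assoc {D₁ D₂ D₃ S₁ S₂ S₃ : Type} (n₁ : Pt D₁ S₁ → Pt D₁ S₁ → Prop)
    (n₂ : Pt D₂ S₂ → Pt D₂ S₂ → Prop) (n₃ : Pt D₃ S₃ → Pt D₃ S₃ → Prop) (z : Pt D₁ S₁)
    (w z' : Pt D₂ S₂) (w' : Pt D₃ S₃) (p q : Pt ((D₁ ⊕ D₂) ⊕ D₃) ((S₁ ⊕ S₂) ⊕ S₃)) :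
    glueNode n₁ (glueNode n₂ n₃ z' w') z (k₁ w)
      (mapPt (Equiv.sumAssoc D₁ D₂ D₃) (Equiv.sumAssoc S₁ S₂ S₃) 1 1 p)
      (mapPt (Equiv.sumAssoc D₁ D₂ D₃) (Equiv.sumAssoc S₁ S₂ S₃) 1 1 q) ↔
    glueNode (glueNode n₁ n₂ z w) n₃ (k₂ z') w' p q := by
  obtain ⟨e1, e2, e3⟩ := mapPt_assoc (D₁ := D₁) (D₂ := D₂) (D₃ := D₃) (S₁ := S₁) (S₂ := S₂)
    (S₃ := S₃)
  induction p using pt_cases₃ <;> induction q using pt_cases₃ <;>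
    simp [e1, e2, e3]

theorem glueNode_swap {D₁ D₂ D₃ S₁ S₂ S₃ : Type} (n₁ : Pt D₁ S₁ → Pt D₁ S₁ → Prop)
    (n₂ : Pt D₂ S₂ → Pt D₂ S₂ → Prop) (n₃ : Pt D₃ S₃ → Pt D₃ S₃ → Prop) (y z : Pt D₁ S₁)
    (w : Pt D₂ S₂) (w' : Pt D₃ S₃) (p q : Pt ((D₁ ⊕ D₂) ⊕ D₃) ((S₁ ⊕ S₂) ⊕ S₃)) :
    glueNode (glueNode n₁ n₃ z w') n₂ (k₁ y) w
      (mapPt (swapSum D₁ D₂ D₃) (swapSum S₁ S₂ S₃) 1 1 p)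
      (mapPt (swapSum D₁ D₂ D₃) (swapSum S₁ S₂ S₃) 1 1 q) ↔
    glueNode (glueNode n₁ n₂ y w) n₃ (k₁ z) w' p q := by
  obtain ⟨e1, e2, e3⟩ := mapPt_swap (D₁ := D₁) (D₂ := D₂) (D₃ := D₃) (S₁ := S₁) (S₂ := S₂)
    (S₃ := S₃)
  induction p using pt_cases₃ <;> induction q using pt_cases₃ <;>
    simp [e1, e2, e3]

variable (P Q : Polygon J ι) {R : Polygon J ι}

theorem Polygon.glue_inputs_seq {pre z post} (hz : P.inputs = pre ++ z :: post)
    (hm : P.ev z = Q.evOut) {pre' z' post'} (hz' : Q.inputs = pre' ++ z' :: post') :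
    (P.glue Q pre z post hz hm).inputs =
      (pre.map b₁ ++ pre'.map b₂) ++ b₂ z' :: (post'.map b₂ ++ post.map b₁) := by
  have e : pre.map b₁ ++ Q.inputs.map b₂ ++ post.map b₁ =
      (pre.map b₁ ++ pre'.map b₂) ++ b₂ z' :: (post'.map b₂ ++ post.map b₁) := by
    rw [hz']
    simp
  exact e

theorem Polygon.glue_inputs_left {pre y mid z post} (hz : P.inputs = pre ++ y :: (mid ++ z :: post))
    (hm : P.ev y = Q.evOut) :
    (P.glue Q pre y (mid ++ z :: post) hz hm).inputs =
      (pre.map b₁ ++ Q.inputs.map b₂ ++ mid.map b₁) ++ b₁ z :: post.map b₁ := by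
  have e : pre.map b₁ ++ Q.inputs.map b₂ ++ (mid ++ z :: post).map b₁ =
      (pre.map b₁ ++ Q.inputs.map b₂ ++ mid.map b₁) ++ b₁ z :: post.map b₁ := by
    simp
  exact e

theorem Polygon.glue_inputs_right {pre y mid z post}
    (hz : P.inputs = (pre ++ y :: mid) ++ z :: post) (hm : P.ev z = Q.evOut) :
    (P.glue Q (pre ++ y :: mid) z post hz hm).inputs =
      pre.map b₁ ++ b₁ y :: (mid.map b₁ ++ Q.inputs.map b₂ ++ post.map b₁) := by
  have e : (pre ++ y :: mid).map b₁ ++ Q.inputs.map b₂ ++ post.map b₁ =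
      pre.map b₁ ++ b₁ y :: (mid.map b₁ ++ Q.inputs.map b₂ ++ post.map b₁) := by
    simp
  exact e

variable {P Q}

/-- Sequential associativity of gluing. -/
def Polygon.assocIso {pre z post} (hz : P.inputs = pre ++ z :: post)
    (hm : P.ev z = Q.evOut) {pre' z' post'} (hz' : Q.inputs = pre' ++ z' :: post')
    (hm' : Q.ev z' = R.evOut) :
    ((P.glue Q pre z post hz hm).glue R (pre.map b₁ ++ pre'.map b₂) (b₂ z')
      (post'.map b₂ ++ post.map b₁) (P.glue_inputs_seq Q hz hm hz') hm').Iso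
      (P.glue (Q.glue R pre' z' post' hz' hm') pre z post hz hm) where
  σ := Equiv.sumAssoc _ _ _
  τ := Equiv.sumAssoc _ _ _
  φ := 1
  ψ := 1
  node_iff p q := glueNode_assoc P.node Q.node R.node (bpt z) (bpt Q.out) (bpt z') (bpt R.out) p q
  out_eq := rfl
  inputs_eq := by
    have h : ∀ (h : ((P.D ⊕ Q.D) ⊕ R.D) × Circle → (P.D ⊕ (Q.D ⊕ R.D)) × Circle),
        (∀ p, h (b₁ (b₁ p)) = b₁ p) → (∀ p, h (b₁ (b₂ p)) = b₂ (b₁ p)) →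
        (∀ p, h (b₂ p) = b₂ (b₂ p)) →
        ((pre.map b₁ ++ pre'.map b₂).map b₁ ++ R.inputs.map b₂ ++
          (post'.map b₂ ++ post.map b₁).map b₁).map h =
        pre.map b₁ ++ (pre'.map b₁ ++ R.inputs.map b₂ ++ post'.map b₁).map b₂ ++ post.map b₁ := by
      intro h h1 h2 h3
      simp [Function.comp_def, h1, h2, h3]
    exact h (mapB (Equiv.sumAssoc P.D Q.D R.D) 1) (fun _ => rfl) (fun _ => rfl) (fun _ => rfl)
  u_eq := by rintro (⟨(_ | _) | _, _⟩ | ⟨(_ | _) | _, _⟩) <;> rfl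
  γm_eq := by rintro ⟨(_ | _) | _, _⟩ <;> rfl
  γp_eq := by rintro ⟨(_ | _) | _, _⟩ <;> rfl

/-- Parallel associativity of gluing. -/
def Polygon.swapIso {pre y mid z post} (hz : P.inputs = pre ++ y :: (mid ++ z :: post))
    (hy : P.ev y = Q.evOut) (hm : P.ev z = R.evOut)
    (hz' : P.inputs = (pre ++ y :: mid) ++ z :: post) :
    ((P.glue Q pre y (mid ++ z :: post) hz hy).glue R
      (pre.map b₁ ++ Q.inputs.map b₂ ++ mid.map b₁) (b₁ z) (post.map b₁)
      (P.glue_inputs_left Q hz hy) hm).Iso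
    ((P.glue R (pre ++ y :: mid) z post hz' hm).glue Q (pre.map b₁) (b₁ y)
      (mid.map b₁ ++ R.inputs.map b₂ ++ post.map b₁) (P.glue_inputs_right R hz' hm) hy) where
  σ := swapSum _ _ _
  τ := swapSum _ _ _
  φ := 1
  ψ := 1
  node_iff p q := glueNode_swap P.node Q.node R.node (bpt y) (bpt z) (bpt Q.out) (bpt R.out) p q
  out_eq := rfl
  inputs_eq := by
    have h : ∀ (h : ((P.D ⊕ Q.D) ⊕ R.D) × Circle → ((P.D ⊕ R.D) ⊕ Q.D) × Circle),
        (∀ p, h (b₁ (b₁ p)) = b₁ (b₁ p)) → (∀ p, h (b₁ (b₂ p)) = b₂ p) →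
        (∀ p, h (b₂ p) = b₁ (b₂ p)) →
        ((pre.map b₁ ++ Q.inputs.map b₂ ++ mid.map b₁).map b₁ ++ R.inputs.map b₂ ++
          (post.map b₁).map b₁).map h =
        (pre.map b₁).map b₁ ++ Q.inputs.map b₂ ++
          (mid.map b₁ ++ R.inputs.map b₂ ++ post.map b₁).map b₁ := by
      intro h h1 h2 h3
      simp [Function.comp_def, h1, h2, h3]
    exact h (mapB (swapSum P.D Q.D R.D) 1) (fun _ => rfl) (fun _ => rfl) (fun _ => rfl)
  u_eq := by rintro (⟨(_ | _) | _, _⟩ | ⟨(_ | _) | _, _⟩) <;> rfl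
  γm_eq := by rintro ⟨(_ | _) | _, _⟩ <;> rfl
  γp_eq := by rintro ⟨(_ | _) | _, _⟩ <;> rfl

end Assoc

/-! ### The moduli spaces and their fc-multicategory structure -/

variable (J ι) in
/-- Isomorphism of stable polygons. -/
instance polygonSetoid : Setoid (StablePolygon J ι) where
  r P Q := Nonempty (P.toPolygon.Iso Q.toPolygon)
  iseqv := ⟨fun P => ⟨.refl _⟩, fun ⟨f⟩ => ⟨f.symm⟩, fun ⟨f⟩ ⟨g⟩ => ⟨f.trans g⟩⟩

variable (J ι) in
/-- Isomorphism classes of stable polygons. -/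
abbrev PolygonClass := Quotient (polygonSetoid J ι)

/-- The list `(ev₁, …, ev_k)`. -/
def PolygonClass.inputs : PolygonClass J ι → List (FibProd ι) :=
  Quotient.lift (fun P => P.inputs.map P.ev) fun _ _ ⟨f⟩ => f.map_ev.symm

/-- The evaluation `ev₀`. -/
def PolygonClass.out : PolygonClass J ι → FibProd ι :=
  Quotient.lift (fun P => P.evOut) fun _ _ ⟨f⟩ => f.evOut_eq.symm

/-- Gluing of stable polygons. -/
def StablePolygon.glue (P Q : StablePolygon J ι) (pre : List (P.D × Circle)) (z : P.D × Circle)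
    (post : List (P.D × Circle)) (hz : P.inputs = pre ++ z :: post) (hm : P.ev z = Q.evOut) :
    StablePolygon J ι where
  toPolygon := P.toPolygon.glue Q.toPolygon pre z post hz hm
  stable := by
    have := P.stable
    have := Q.stable
    exact Polygon.glue_stable

theorem PolygonClass.exists_comp (x y : PolygonClass J ι) (a b : List (FibProd ι))
    (h : x.inputs = a ++ y.out :: b) : ∃ w : PolygonClass J ι, ∀ (P Q : StablePolygon J ι) pre z post
      (hz : P.inputs = pre ++ z :: post) (hm : P.ev z = Q.evOut), ⟦P⟧ = x → ⟦Q⟧ = y →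
      pre.map P.ev = a → w = ⟦P.glue Q pre z post hz hm⟧ := by
  induction x using Quotient.inductionOn with | _ P
  induction y using Quotient.inductionOn with | _ Q
  have h' : P.inputs.map P.ev = a ++ Q.evOut :: b := h
  rw [List.map_eq_append_iff] at h'
  obtain ⟨pre, l, hl, hpre, h'⟩ := h'
  rw [List.map_eq_cons_iff] at h'
  obtain ⟨z, post, rfl, hzz, -⟩ := h'
  refine ⟨⟦P.glue Q pre z post hl hzz⟧, ?_⟩
  intro P' Q' pre' z' post' hz' hm' hP hQ hpre'
  obtain ⟨f⟩ := Quotient.exact hP.symm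
  obtain ⟨g⟩ := Quotient.exact hQ.symm
  have e := f.inputs_eq
  rw [hl, hz', List.map_append, List.map_cons] at e
  have hlen : (pre.map (mapB f.σ f.φ)).length = pre'.length := by
    have h1 := congrArg List.length hpre
    have h2 := congrArg List.length hpre'
    simp only [List.length_map] at h1 h2 ⊢
    omega
  obtain ⟨e1, e2⟩ := List.append_inj e hlen
  rw [List.cons.injEq] at e2
  exact Quotient.sound ⟨Polygon.glueIso (hm := hzz) (hm' := hm') f g e1 e2.1 e2.2⟩

/-- Partial composition of isomorphism classes, by gluing representatives. -/
def PolygonClass.comp (x y : PolygonClass J ι) (a b : List (FibProd ι))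
    (h : x.inputs = a ++ y.out :: b) : PolygonClass J ι :=
  (PolygonClass.exists_comp x y a b h).choose

theorem PolygonClass.comp_mk (P Q : StablePolygon J ι) (a b : List (FibProd ι))
    (h : PolygonClass.inputs ⟦P⟧ = a ++ PolygonClass.out ⟦Q⟧ :: b) (pre z post)
    (hz : P.inputs = pre ++ z :: post) (hm : P.ev z = Q.evOut) (ha : pre.map P.ev = a) :
    PolygonClass.comp ⟦P⟧ ⟦Q⟧ a b h = ⟦P.glue Q pre z post hz hm⟧ :=
  (PolygonClass.exists_comp _ _ a b h).choose_spec P Q pre z post hz hm rfl rfl ha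

theorem PolygonClass.inputs_split (P : StablePolygon J ι) {a b : List (FibProd ι)} {e : FibProd ι}
    (h : PolygonClass.inputs ⟦P⟧ = a ++ e :: b) : ∃ pre z post, P.inputs = pre ++ z :: post ∧
      P.ev z = e ∧ pre.map P.ev = a ∧ post.map P.ev = b := by
  have h' : P.inputs.map P.ev = a ++ e :: b := h
  rw [List.map_eq_append_iff] at h'
  obtain ⟨pre, l, hl, hpre, h'⟩ := h'
  rw [List.map_eq_cons_iff] at h'
  obtain ⟨z, post, rfl, hzz, hb⟩ := h'
  exact ⟨pre, z, post, hl, hzz, hpre, hb⟩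

theorem PolygonClass.inputs_comp (x y : PolygonClass J ι) (a b : List (FibProd ι))
    (h : x.inputs = a ++ y.out :: b) : (x.comp y a b h).inputs = a ++ y.inputs ++ b := by
  induction x using Quotient.inductionOn with | _ P
  induction y using Quotient.inductionOn with | _ Q
  obtain ⟨pre, z, post, hz, hm, rfl, rfl⟩ := PolygonClass.inputs_split P h
  rw [PolygonClass.comp_mk P Q _ _ h pre z post hz hm rfl]
  exact P.glue_map_ev Q.toPolygon pre z post hz hm

theorem PolygonClass.out_comp (x y : PolygonClass J ι) (a b : List (FibProd ι))
    (h : x.inputs = a ++ y.out :: b) : (x.comp y a b h).out = x.out := by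
  induction x using Quotient.inductionOn with | _ P
  induction y using Quotient.inductionOn with | _ Q
  obtain ⟨pre, z, post, hz, hm, rfl, rfl⟩ := PolygonClass.inputs_split P h
  rw [PolygonClass.comp_mk P Q _ _ h pre z post hz hm rfl]
  rfl

theorem PolygonClass.profile (x : PolygonClass J ι) :
    (immersionGraph ι).IsProfileLoop x.inputs x.out := by
  induction x using Quotient.inductionOn with | _ P
  exact P.toPolygon.profile

theorem PolygonClass.assoc_seq (x y z : PolygonClass J ι) (a b a' b' : List (FibProd ι))
    (h : x.inputs = a ++ y.out :: b) (h' : y.inputs = a' ++ z.out :: b')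
    (h₁ : (x.comp y a b h).inputs = (a ++ a') ++ z.out :: (b' ++ b))
    (h₂ : x.inputs = a ++ (y.comp z a' b' h').out :: b) :
    (x.comp y a b h).comp z (a ++ a') (b' ++ b) h₁ = x.comp (y.comp z a' b' h') a b h₂ := by
  induction x using Quotient.inductionOn with | _ P
  induction y using Quotient.inductionOn with | _ Q
  induction z using Quotient.inductionOn with | _ R
  obtain ⟨pre, z, post, hz, hm, rfl, rfl⟩ := PolygonClass.inputs_split P h
  obtain ⟨pre', z', post', hz', hm', rfl, rfl⟩ := PolygonClass.inputs_split Q h'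
  revert h₁ h₂
  rw [PolygonClass.comp_mk P Q _ _ h pre z post hz hm rfl,
    PolygonClass.comp_mk Q R _ _ h' pre' z' post' hz' hm' rfl]
  intro h₁ h₂
  rw [PolygonClass.comp_mk P (Q.glue R pre' z' post' hz' hm') _ _ h₂ pre z post hz hm rfl,
    PolygonClass.comp_mk (P.glue Q pre z post hz hm) R _ _ h₁ (pre.map b₁ ++ pre'.map b₂) (b₂ z')
      (post'.map b₂ ++ post.map b₁) (P.glue_inputs_seq Q.toPolygon hz hm hz') hm' ?_]
  · exact Quotient.sound ⟨Polygon.assocIso hz hm hz' hm'⟩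
  · have e : ∀ (f : (P.D ⊕ Q.D) × Circle → FibProd ι), (pre.map b₁ ++ pre'.map b₂).map f =
      pre.map (f ∘ b₁) ++ pre'.map (f ∘ b₂) := fun f => by simp
    exact e (P.toPolygon.glue Q.toPolygon pre z post hz hm).ev

theorem PolygonClass.assoc_par (x y z : PolygonClass J ι) (a b b' : List (FibProd ι))
    (h : x.inputs = a ++ y.out :: (b ++ z.out :: b'))
    (h₁ : (x.comp y a (b ++ z.out :: b') h).inputs = (a ++ y.inputs ++ b) ++ z.out :: b')
    (h₂ : x.inputs = (a ++ y.out :: b) ++ z.out :: b')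
    (h₃ : (x.comp z (a ++ y.out :: b) b' h₂).inputs = a ++ y.out :: (b ++ z.inputs ++ b')) :
    (x.comp y a (b ++ z.out :: b') h).comp z (a ++ y.inputs ++ b) b' h₁ =
      (x.comp z (a ++ y.out :: b) b' h₂).comp y a (b ++ z.inputs ++ b') h₃ := by
  induction x using Quotient.inductionOn with | _ P
  induction y using Quotient.inductionOn with | _ Q
  induction z using Quotient.inductionOn with | _ R
  obtain ⟨pre, y, post₀, hy, hmy, rfl, hp⟩ := PolygonClass.inputs_split P h
  rw [List.map_eq_append_iff] at hp
  obtain ⟨mid, l, rfl, rfl, hp⟩ := hp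
  rw [List.map_eq_cons_iff] at hp
  obtain ⟨z, post, rfl, hmz, rfl⟩ := hp
  have hz : P.inputs = (pre ++ y :: mid) ++ z :: post := by rw [hy]; simp
  have e2 : (pre ++ y :: mid).map P.ev =
      pre.map P.ev ++ PolygonClass.out ⟦Q⟧ :: mid.map P.ev := by
    rw [List.map_append, List.map_cons, hmy]
  revert h₁ h₃
  rw [PolygonClass.comp_mk P Q _ _ h pre y (mid ++ z :: post) hy hmy rfl,
    PolygonClass.comp_mk P R _ _ h₂ (pre ++ y :: mid) z post hz hmz e2]
  intro h₁ h₃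
  rw [PolygonClass.comp_mk (P.glue Q pre y (mid ++ z :: post) hy hmy) R _ _ h₁
      (pre.map b₁ ++ Q.inputs.map b₂ ++ mid.map b₁) (b₁ z) (post.map b₁)
      (P.glue_inputs_left Q.toPolygon hy hmy) hmz ?_,
    PolygonClass.comp_mk (P.glue R (pre ++ y :: mid) z post hz hmz) Q _ _ h₃ (pre.map b₁) (b₁ y)
      (mid.map b₁ ++ R.inputs.map b₂ ++ post.map b₁) (P.glue_inputs_right R.toPolygon hz hmz) hmy
      ?_]
  · exact Quotient.sound ⟨Polygon.swapIso hy hmy hmz hz⟩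
  · exact List.map_map
  · exact map_three b₁ b₂ (P.toPolygon.glue Q.toPolygon pre y (mid ++ z :: post) hy hmy).ev
      pre Q.inputs mid

variable (J ι) in
/-- The set of 2-cells: isomorphism classes of stable polygons, together with a formal identity
2-cell (the trivial polygon with one input) for each point of `L ×_X L`. -/
abbrev Moduli := FibProd ι ⊕ PolygonClass J ι

namespace Moduli

/-- The domain `(ev₁, …, ev_k)`. -/
def d : Moduli J ι → List (FibProd ι) := Sum.elim (fun e => [e]) PolygonClass.inputs

/-- The codomain `ev₀`. -/
def c : Moduli J ι → FibProd ι := Sum.elim id PolygonClass.out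

/-- Partial composition: gluing, with the formal identities acting as units. -/
def comp : ∀ (x y : Moduli J ι) (a b : List (FibProd ι)), d x = a ++ c y :: b → Moduli J ι
  | Sum.inl _, y, _, _, _ => y
  | Sum.inr x, Sum.inl _, _, _, _ => Sum.inr x
  | Sum.inr x, Sum.inr y, a, b, h => Sum.inr (x.comp y a b h)

theorem single_eq {α : Type*} {e e' : α} {a b : List α} (h : [e] = a ++ e' :: b) :
    a = [] ∧ b = [] ∧ e' = e := by
  rcases a with _ | ⟨_, a⟩ <;> simp_all

theorem comp_congr {x y : Moduli J ι} {a a' b b' : List (FibProd ι)} (ha : a = a') (hb : b = b')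
    (h : d x = a ++ c y :: b) (h' : d x = a' ++ c y :: b') : comp x y a b h = comp x y a' b' h' := by
  subst ha hb
  rfl

theorem comp_inl (x : Moduli J ι) (e : FibProd ι) (a b : List (FibProd ι))
    (h : d x = a ++ c (Sum.inl e : Moduli J ι) :: b) : comp x (Sum.inl e) a b h = x := by
  rcases x with e' | x
  · exact congrArg Sum.inl (single_eq h).2.2
  · rfl

theorem d_comp (x y : Moduli J ι) (a b : List (FibProd ι)) (h : d x = a ++ c y :: b) :
    d (comp x y a b h) = a ++ d y ++ b := by
  rcases x with e | x
  · obtain ⟨rfl, rfl, -⟩ := single_eq h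
    simp [comp]
  · rcases y with e | y
    · exact h.trans (by simp [d, c])
    · exact x.inputs_comp y a b h

theorem c_comp (x y : Moduli J ι) (a b : List (FibProd ι)) (h : d x = a ++ c y :: b) :
    c (comp x y a b h) = c x := by
  rcases x with e | x
  · exact (single_eq h).2.2
  · rcases y with e | y
    · rfl
    · exact x.out_comp y a b h

theorem assoc_seq (x y z : Moduli J ι) (a b a' b' : List (FibProd ι)) (h : d x = a ++ c y :: b)
    (h' : d y = a' ++ c z :: b') (h₁ : d (comp x y a b h) = (a ++ a') ++ c z :: (b' ++ b))
    (h₂ : d x = a ++ c (comp y z a' b' h') :: b) :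
    comp (comp x y a b h) z (a ++ a') (b' ++ b) h₁ = comp x (comp y z a' b' h') a b h₂ := by
  rcases x with e | x
  · obtain ⟨rfl, rfl, -⟩ := single_eq h
    exact comp_congr (x := y) rfl (List.append_nil _) _ h'
  · rcases y with e' | y
    · obtain ⟨rfl, rfl, h0⟩ := single_eq h'
      rcases z with e'' | z
      · rfl
      · exact comp_congr (x := Sum.inr x) (y := Sum.inr z) (List.append_nil _) rfl _ _
    · rcases z with e'' | z
      · rfl
      · exact congrArg Sum.inr (x.assoc_seq y z a b a' b' h h' h₁ h₂)

theorem assoc_par (x y z : Moduli J ι) (a b b' : List (FibProd ι))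
    (h : d x = a ++ c y :: (b ++ c z :: b'))
    (h₁ : d (comp x y a (b ++ c z :: b') h) = (a ++ d y ++ b) ++ c z :: b')
    (h₂ : d x = (a ++ c y :: b) ++ c z :: b')
    (h₃ : d (comp x z (a ++ c y :: b) b' h₂) = a ++ c y :: (b ++ d z ++ b')) :
    comp (comp x y a (b ++ c z :: b') h) z (a ++ d y ++ b) b' h₁ =
      comp (comp x z (a ++ c y :: b) b' h₂) y a (b ++ d z ++ b') h₃ := by
  rcases x with e | x
  · have := (single_eq h).2.1
    simp at this
  · rcases y with e' | y <;> rcases z with e'' | z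
    · rfl
    · refine comp_congr (x := Sum.inr x) (y := Sum.inr z) ?_ rfl _ _
      simp [d, c]
    · refine comp_congr (x := Sum.inr x) (y := Sum.inr y) rfl ?_ _ _
      simp [d, c]
    · exact congrArg Sum.inr (x.assoc_par y z a b b' h h₁ h₂ h₃)

end Moduli

variable (J ι) in
/-- The vertically discrete fc-multicategory `(π₀(L), L ×_X L, 𝓜)` of pseudo-holomorphic polygons
with boundary on `ι : L → X`. -/
def moduliFc : FcMulticategory (immersionGraph ι) where
  Cell := Moduli J ι
  d := Moduli.d
  c := Moduli.c
  profile := by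
    rintro (e | x)
    · exact ⟨rfl, rfl⟩
    · exact x.profile
  one := Sum.inl
  d_one _ := rfl
  c_one _ := rfl
  comp := Moduli.comp
  d_comp := Moduli.d_comp
  c_comp := Moduli.c_comp
  one_comp _ _ _ _ _ := rfl
  comp_one := Moduli.comp_inl
  assoc_seq x y z a b a' b' h h' := Moduli.assoc_seq x y z a b a' b' h h' _ _
  assoc_par x y z a b b' h := Moduli.assoc_par x y z a b b' h _ _ _

end Polygons

/-! ### Symplectic manifolds, almost complex structures and Lagrangians -/

section Symplectic

variable {E : Type*} [NormedAddCommGroup E] [NormedSpace ℝ E] (X : Type u) [TopologicalSpace X]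
  [ChartedSpace E X]

variable {X} in
/-- The coordinate expression of a 2-form in the chart `e`. -/
def formInChart (ω : ∀ x : X, TangentSpace 𝓘(ℝ, E) x [⋀^Fin 2]→L[ℝ] ℝ)
    (e : OpenPartialHomeomorph X E) (y : E) : E [⋀^Fin 2]→L[ℝ] ℝ :=
  (ω (e.symm y)).compContinuousLinearMap (mfderiv 𝓘(ℝ, E) 𝓘(ℝ, E) e.symm y)

variable {X} in
/-- The coordinate expression of an endomorphism of the tangent bundle in the chart `e`. -/
def endInChart (J : ∀ x : X, TangentSpace 𝓘(ℝ, E) x →L[ℝ] TangentSpace 𝓘(ℝ, E) x)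
    (e : OpenPartialHomeomorph X E) (y : E) : E →L[ℝ] E :=
  (mfderiv 𝓘(ℝ, E) 𝓘(ℝ, E) e (e.symm y)).comp
    ((J (e.symm y)).comp (mfderiv 𝓘(ℝ, E) 𝓘(ℝ, E) e.symm y))

/-- A symplectic form on `X`: a nondegenerate 2-form which in every chart of the atlas is smooth
and closed. -/
structure SymplecticForm where
  form : ∀ x : X, TangentSpace 𝓘(ℝ, E) x [⋀^Fin 2]→L[ℝ] ℝ
  smooth : ∀ e ∈ atlas E X, ContDiffOn ℝ (⊤ : ℕ∞) (formInChart form e) e.target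
  closed : ∀ e ∈ atlas E X, ∀ y ∈ e.target, extDeriv (formInChart form e) y = 0
  nondegenerate : ∀ x (v : TangentSpace 𝓘(ℝ, E) x), (∀ w, form x ![v, w] = 0) → v = 0

/-- An almost complex structure on `X`: an endomorphism `J` of the tangent bundle with `J² = -1`
which is smooth in every chart of the atlas. -/
structure AlmostComplexStructure where
  J : ∀ x : X, TangentSpace 𝓘(ℝ, E) x →L[ℝ] TangentSpace 𝓘(ℝ, E) x
  smooth : ∀ e ∈ atlas E X, ContDiffOn ℝ (⊤ : ℕ∞) (endInChart J e) e.target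
  sq : ∀ x v, J x (J x v) = -v

variable {X}

/-- `J` is `ω`-tame: `ω(v, Jv) > 0` for all `v ≠ 0`. -/
def AlmostComplexStructure.IsTame (J : AlmostComplexStructure (E := E) X)
    (ω : SymplecticForm (E := E) X) : Prop :=
  ∀ x (v : TangentSpace 𝓘(ℝ, E) x), v ≠ 0 → 0 < ω.form x ![v, J.J x v]

end Symplectic

section Lagrangian

variable {n : ℕ} {X : Type u} [TopologicalSpace X] [ChartedSpace (EuclideanSpace ℝ (Fin (2 * n))) X]

/-- `f` is an embedded Lagrangian submanifold of the `2n`-dimensional symplectic manifold `X`: a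
smooth embedding of an `n`-dimensional manifold such that the pullback of `ω` vanishes. -/
structure IsLagrangianEmbedding (ω : SymplecticForm (E := EuclideanSpace ℝ (Fin (2 * n))) X)
    {M : Type v} [TopologicalSpace M] [ChartedSpace (EuclideanSpace ℝ (Fin n)) M] (f : M → X) :
    Prop where
  embedding : Manifold.IsSmoothEmbedding 𝓘(ℝ, EuclideanSpace ℝ (Fin n))
    𝓘(ℝ, EuclideanSpace ℝ (Fin (2 * n))) (⊤ : ℕ∞) f
  isotropic : ∀ (p : M) (v w : TangentSpace 𝓘(ℝ, EuclideanSpace ℝ (Fin n)) p),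
    ω.form (f p)
      ![mfderiv 𝓘(ℝ, EuclideanSpace ℝ (Fin n)) 𝓘(ℝ, EuclideanSpace ℝ (Fin (2 * n))) f p v,
        mfderiv 𝓘(ℝ, EuclideanSpace ℝ (Fin n)) 𝓘(ℝ, EuclideanSpace ℝ (Fin (2 * n))) f p w] = 0

/-- The tangent plane of `f` at `p`, as a subspace of the model space in which the tangent space
of `X` at `f p` is represented. -/
def tangentPlane {M : Type v} [TopologicalSpace M] [ChartedSpace (EuclideanSpace ℝ (Fin n)) M]
    (f : M → X) (p : M) : Submodule ℝ (EuclideanSpace ℝ (Fin (2 * n))) :=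
  let D : EuclideanSpace ℝ (Fin n) →L[ℝ] EuclideanSpace ℝ (Fin (2 * n)) :=
    mfderiv 𝓘(ℝ, EuclideanSpace ℝ (Fin n)) 𝓘(ℝ, EuclideanSpace ℝ (Fin (2 * n))) f p
  LinearMap.range D.toLinearMap

/-- `f` and `g` intersect transversely: at every intersection point the tangent planes span the
tangent space of `X`. -/
def AreTransverse {M M' : Type v} [TopologicalSpace M] [ChartedSpace (EuclideanSpace ℝ (Fin n)) M]
    [TopologicalSpace M'] [ChartedSpace (EuclideanSpace ℝ (Fin n)) M'] (f : M → X) (g : M' → X) :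
    Prop :=
  ∀ (p : M) (q : M'), f p = g q → tangentPlane (n := n) f p ⊔ tangentPlane (n := n) g q = ⊤

end Lagrangian

/-! ### Collections of Lagrangians and partitions of the index set -/

/-- The index set `{0, …, N}`, which is the set of all natural numbers if `N = ∞`. -/
abbrev IndexSet (N : ℕ∞) : Type := {i : ℕ // (i : ℕ∞) ≤ N}

/-- The map `ι_N : L = L₀ ⊔ L₁ ⊔ ⋯ → X` given by a collection of maps `L_i → X`. -/
def unionMap {N : ℕ∞} {X : Type u} {L : IndexSet N → Type v} (f : ∀ i, L i → X) :
    (Σ i, L i) → X := fun p => f p.1 p.2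

/-- The subgraph `E₀ = (L' ×_X L') ∪ (L' ×_X L'') ∪ (L'' ×_X L'')` of `E = L ×_X L`, on all
vertices, determined by subsets `V'` and `V''` of the index set; here `L'` and `L''` are the unions
of the `L_i` with `i ∈ V'` and with `i ∈ V''`. -/
def partitionSubgraph {N : ℕ∞} {X : Type u} {L : IndexSet N → Type v}
    [∀ i, TopologicalSpace (L i)] (f : ∀ i, L i → X) (V' V'' : Set (IndexSet N)) :
    (immersionGraph (unionMap f)).Subgraph where
  verts := univ
  edges :=
    let L' : Set (Σ i, L i) := Sigma.fst ⁻¹' V'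
    let L'' : Set (Σ i, L i) := Sigma.fst ⁻¹' V''
    {e : FibProd (unionMap f) | e.1 ∈ L' ×ˢ L' ∪ L' ×ˢ L'' ∪ L'' ×ˢ L''}
  s_mem _ _ := mem_univ _
  t_mem _ _ := mem_univ _

end

end FcPoly

namespace FcPoly

universe u w

/-! The statement is a fact about directed graphs. In a partial composition `M.comp x y a b h` the
boundary of the composite retains every edge of the boundaries of `x` and `y` except one: the edge
`M.c y`, which is at once the output of `y` and the input of `x` that is filled. The domain of the
composite is `a ++ M.d y ++ b` and its codomain is `M.c x`, so if the composite lies in a full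
fc-submulticategory, the only thing left to prove is that this hidden edge belongs to the subgraph.
Nothing about `x` is needed for that: `y` is a 2-cell, hence its inputs form a composable path with
the same endpoints as `M.c y`, and these inputs are visible in the composite. It therefore suffices
that the subgraph contains every edge whose endpoints can be joined by a path inside the subgraph.
This reduction is `FcMulticategory.full_factorClosed`.

For the subgraph of a partition the criterion holds because `V''` is absorbing. The edges of `E₀`
are exactly those that do not lead from `L''` to `L'`, so a path in `E₀` that starts in `L''` can
never return to `L'`. Hence no edge from `L''` to `L'` has the endpoints of a path in `E₀`, and
every edge closing up such a path lies in `E₀` itself. Equivalently, order the two parts by `L' <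
L''`: the edges of `E₀` are those along which the part does not decrease, and this property passes
from the edges of a path to its pair of endpoints by transitivity. The empty path corresponds to
reflexivity; it takes care of polygons without inputs, whose output runs from a component to itself.

The lemma `DirGraph.IsPath.mem_of_mem` is the propagation along a path, and
`mem_partitionSubgraph_edges` identifies `E₀` with the edges that preserve membership in `V''`.
Since vertices are connected components of `L` whereas the partition concerns indices,
`componentIndex` carries the absorbing set from indices to vertices. The geometric input is hidden
in the field `profile` of `moduliFc`: the lift of the boundary to `L` is continuous along each arc
and continues across boundary nodes, so between consecutive marked points it stays in one component.
-/

/-- The full fc-submulticategory on a subgraph is factor-closed if every edge with the same endpoints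
as a composable path in the subgraph lies in the subgraph. -/
theorem FcMulticategory.full_factorClosed {G : DirGraph.{u}} (M : FcMulticategory.{u, w} G)
    (G₀ : G.Subgraph)
    (hG₀ : ∀ es e, G.IsProfileLoop es e → (∀ e' ∈ es, e' ∈ G₀.edges) → e ∈ G₀.edges) :
    (M.full G₀).FactorClosed := by
  rintro x y a b h ⟨hd, hc⟩
  -- The cells of `M.full G₀` are the set of 2-cells with all boundary edges in `G₀`; naming
  -- `M.comp` and `G₀.edges` explicitly makes the boundary formulas `M.d_comp` and `M.c_comp`
  -- applicable.
  change ∀ e ∈ M.d (M.comp x y a b h), e ∈ G₀.edges at hd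
  change M.c (M.comp x y a b h) ∈ G₀.edges at hc
  simp only [M.d_comp, List.mem_append] at hd
  rw [M.c_comp] at hc
  -- The domain of the composite is bracketed as `(a ++ M.d y) ++ b`, so the inputs of `y` sit in
  -- the middle block.
  have hy : ∀ e ∈ M.d y, e ∈ G₀.edges := fun e he => hd e (Or.inl (Or.inr he))
  -- This is the crucial step. The glued edge does not occur in the boundary of the composite by
  -- virtue of the composition formulas, but it closes the path `M.d y`, all of whose edges are now
  -- known to lie in `G₀`. If `y` has no inputs, the path is empty and the hypothesis on the edges
  -- is vacuous; `hG₀` still applies.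
  have hcy : M.c y ∈ G₀.edges := hG₀ _ _ (M.profile y) hy
  refine ⟨⟨fun e he => ?_, hc⟩, hy, hcy⟩
  -- By `h` the inputs of `x` are the outer blocks `a` and `b`, which survive in the composite, and
  -- the filled slot between them, which is `M.c y`.
  rw [h, List.mem_append, List.mem_cons] at he
  rcases he with he | rfl | he
  · exact hd e (Or.inl (Or.inl he))
  · exact hcy
  · exact hd e (Or.inr he)

/-- If no edge of a path leaves the set `A` of vertices, then neither does the path. -/
theorem DirGraph.IsPath.mem_of_mem {G : DirGraph.{u}} {A : Set G.V} {es : List G.E} {x y : G.V}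
    (h : G.IsPath x es y) (hes : ∀ e ∈ es, G.s e ∈ A → G.t e ∈ A) (hx : x ∈ A) : y ∈ A := by
  -- Paths are read from their first edge, so the starting vertex moves from the source to the
  -- target of that edge in the inductive step and must be allowed to vary.
  induction es generalizing x with
  | nil => exact h ▸ hx
  | cons e es ih =>
    -- The starting vertex is the source of `e`. The condition on `e` transports membership in `A`
    -- to its target, where the remaining path begins.
    obtain ⟨rfl, h⟩ := h
    exact ih h (fun e' he' => hes e' (List.mem_cons_of_mem _ he'))
      (hes e List.mem_cons_self hx)

/-- The index of a connected component of a disjoint union. -/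
def componentIndex {ι : Type*} {L : ι → Type*} [∀ i, TopologicalSpace (L i)] :
    ConnectedComponents (Σ i, L i) → ι :=
  -- The bottom element of the lattice of topologies is the discrete one. A discrete space is
  -- totally disconnected, so a continuous map into it is constant on connected components and
  -- factors through `ConnectedComponents`. The topology serves only this construction and does not
  -- appear in the type of the resulting map.
  letI : TopologicalSpace ι := ⊥
  haveI : DiscreteTopology ι := ⟨rfl⟩
  Continuous.connectedComponentsLift (f := Sigma.fst)
    -- Continuity out of a disjoint union is tested on each summand, where the index is constant.
    (continuous_sigma fun _ => continuous_const)

/-- Because `V'` is the complement of `V''`, the three products making up `E₀` exhaust all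
combinations of parts except source in `V''` and target in `V'`. Stated as an implication,
membership takes precisely the shape that propagates along paths, both as the hypothesis on single
edges and as the conclusion on the endpoints. -/
theorem mem_partitionSubgraph_edges {N : ℕ∞} {X : Type*} {L : IndexSet N → Type*}
    [∀ i, TopologicalSpace (L i)] (f : ∀ i, L i → X) {V' V'' : Set (IndexSet N)}
    (hdisj : Disjoint V' V'') (hunion : V' ∪ V'' = Set.univ) (e : FibProd (unionMap f)) :
    e ∈ (partitionSubgraph f V' V'').edges ↔ (e.1.1.1 ∈ V'' → e.1.2.1 ∈ V'') := by
  -- Disjointness gives one direction and the covering condition the other. Afterwards `V'` can be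
  -- eliminated in favour of `V''`.
  have h : ∀ v, v ∈ V' ↔ v ∉ V'' := fun v =>
    ⟨fun h h' => Set.disjoint_left.1 hdisj h h', fun h =>
      (show v ∈ V' ∪ V'' from hunion ▸ Set.mem_univ v).resolve_right h⟩
  -- In `e.1.1.1` and `e.1.2.1` the projections pass from the edge to its pair of points of `L`,
  -- then to the first or second point, then to the index of the Lagrangian containing it.
  change (((e.1.1.1 ∈ V' ∧ e.1.2.1 ∈ V') ∨ (e.1.1.1 ∈ V' ∧ e.1.2.1 ∈ V'')) ∨
    (e.1.1.1 ∈ V'' ∧ e.1.2.1 ∈ V'')) ↔ _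
  rw [h, h]
  -- With `s` and `t` for the source and the target lying in `V''`, what remains is that `(¬s ∧ ¬t)
  -- ∨ (¬s ∧ t) ∨ (s ∧ t)` is equivalent to `s → t`.
  tauto

end FcPoly

/-- The proof verifies the path criterion of `FcMulticategory.full_factorClosed` for the partition
subgraph, with the components of `L` indexed by `V''` as absorbing set. Formal identities and
isomorphism classes of polygons need no separate treatment, because the criterion sees a 2-cell only
through its profile-loop. -/
theorem mainTheorem8 {n : ℕ} {X : Type*} [TopologicalSpace X] [T2Space X] [CompactSpace X]
    [ChartedSpace (EuclideanSpace ℝ (Fin (2 * n))) X]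
    [IsManifold 𝓘(ℝ, EuclideanSpace ℝ (Fin (2 * n))) (⊤ : ℕ∞) X]
    (ω : FcPoly.SymplecticForm (E := EuclideanSpace ℝ (Fin (2 * n))) X)
    (J : FcPoly.AlmostComplexStructure (E := EuclideanSpace ℝ (Fin (2 * n))) X) (hJ : J.IsTame ω)
    (N : ℕ∞) (hN : 1 ≤ N) (L : FcPoly.IndexSet N → Type*)
    [∀ i, TopologicalSpace (L i)] [∀ i, ChartedSpace (EuclideanSpace ℝ (Fin n)) (L i)]
    [∀ i, IsManifold 𝓘(ℝ, EuclideanSpace ℝ (Fin n)) (⊤ : ℕ∞) (L i)] [∀ i, ConnectedSpace (L i)]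
    (f : ∀ i, L i → X) (hL : ∀ i, FcPoly.IsLagrangianEmbedding ω (f i))
    (htrans : ∀ i j, i ≠ j → FcPoly.AreTransverse (n := n) (f i) (f j))
    (V' V'' : Set (FcPoly.IndexSet N)) (hdisj : Disjoint V' V'') (hunion : V' ∪ V'' = Set.univ) :
    ((FcPoly.moduliFc J.J (FcPoly.unionMap f)).full
      (FcPoly.partitionSubgraph f V' V'')).FactorClosed := by
  refine FcPoly.FcMulticategory.full_factorClosed _ _ fun es e hloop hes => ?_
  -- The goal becomes an implication: if the source of the closing edge `e` lies over `V''`, then so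
  -- does its target.
  refine (FcPoly.mem_partitionSubgraph_edges f hdisj hunion e).2 ?_
  -- On the class of a point `p` the map `componentIndex` reduces definitionally to `p.1`. Hence the
  -- source of an edge lies in `A` exactly when the index of its first point is in `V''`, and
  -- likewise for the target, without any rewriting.
  let A : Set (ConnectedComponents (Σ i, L i)) := FcPoly.componentIndex ⁻¹' V''
  -- The loop condition `hloop` is a path from the source of `e` to its target. Leaving out the last
  -- argument of the lemma, the membership of the starting vertex in `A`, yields the required
  -- implication for `e`.
  exact FcPoly.DirGraph.IsPath.mem_of_mem (A := A) hloop
    fun e he => (FcPoly.mem_partitionSubgraph_edges f hdisj hunion e).1 (hes e he)
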